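/- Let $\Omega\subset\mathbb C^2$ be a connected open set and let $v_1,v_2,v_3$ be holomorphic vector fields on $\Omega$ that are pairwise linearly independent at every point; their integral curves form three foliations, i.e. a 3-web on $\Omega$. A 3-web is called flat if around every point there is a local biholomorphism that maps the leaves of each of the three foliations into parallel lines. A holomorphic vector field is an infinitesimal symmetry of the web if its local flow maps each of the three foliations to itself. Assume that the 3-web of $\{v_1,v_2,v_3\}$ is not flat, and let $Y$ be a holomorphic vector field on $\Omega$. (1) If $Y$ does not vanish identically and is an infinitesimal symmetry of the web, then the set $T\subset\Omega$ of points at which $Y$ is linearly independent of each of $v_1$, $v_2$, $v_3$ is dense in $\Omega$, and the three 3-webs generated on $T$ by $\{Y,v_2,v_3\}$, $\{v_1,Y,v_3\}$ and $\{v_1,v_2,Y\}$ are flat. (2) Suppose that $Y$ is linearly independent of each of $v_1,v_2,v_3$ at every point of $\Omega$, so that $\{Y,v_2,v_3\}$, $\{v_1,Y,v_3\}$ and $\{v_1,v_2,Y\}$ generate 3-webs on $\Omega$. These three 3-webs are all flat if and only if, up to rescaling, $Y$ is an infinitesimal symmetry of the web of $\{v_1,v_2,v_3\}$, i.e. around every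 point of $\Omega$ there is a nowhere vanishing holomorphic function $f$ such that $fY$ is an infinitesimal symmetry. -/

import Mathlib

open Set

/-- The complex plane with coordinates `(x, y)`. -/
abbrev Plane : Type := ℂ × ℂ

/-- The triple of vector fields `v 0`, `v 1`, `v 2` generates a 3-web on `Ω`: the three fields are
holomorphic on `Ω` and pairwise transverse (in particular non-vanishing) at every point of `Ω`.
The three foliations of the web consist of the integral curves of the three fields. -/
structure IsWeb (Ω : Set Plane) (v : Fin 3 → Plane → Plane) : Prop where
  holomorphic : ∀ i, AnalyticOnNhd ℂ (v i) Ω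
  transverse : ∀ i j, i ≠ j → ∀ p ∈ Ω, LinearIndependent ℂ ![v i p, v j p]

/-- The local biholomorphism `φ` maps the leaves of each of the three foliations into parallel
lines: the image of the `i`-th direction field has a direction `w i` that does not depend on the
point. -/
def MapsToParallelLines (φ : OpenPartialHomeomorph Plane Plane)
    (v : Fin 3 → Plane → Plane) : Prop :=
  ∃ w : Fin 3 → Plane, ∀ i, ∀ q ∈ φ.source, fderiv ℂ φ q (v i q) ∈ Submodule.span ℂ {w i}

/-- `v` generates a 3-web on `Ω` which is flat: around every point of `Ω` there is a local
biholomorphism that maps it to a web formed by three families of parallel lines. -/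
def IsFlatWeb (Ω : Set Plane) (v : Fin 3 → Plane → Plane) : Prop :=
  IsWeb Ω v ∧ ∀ p ∈ Ω, ∃ φ : OpenPartialHomeomorph Plane Plane,
    p ∈ φ.source ∧ φ.source ⊆ Ω ∧
    AnalyticOnNhd ℂ φ φ.source ∧ AnalyticOnNhd ℂ φ.symm φ.target ∧
    MapsToParallelLines φ v

/-- `Φ` is the local flow of the vector field `Y` on `Ω`, for initial points in `U` and for
(complex) times `t` with `|t| < ε`. -/
structure IsLocalFlow (Ω : Set Plane) (Y : Plane → Plane) (U : Set Plane) (ε : ℝ)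
    (Φ : ℂ → Plane → Plane) : Prop where
  isOpen : IsOpen U
  subset : U ⊆ Ω
  pos : 0 < ε
  holomorphic : AnalyticOnNhd ℂ (fun z : ℂ × Plane => Φ z.1 z.2) (Metric.ball 0 ε ×ˢ U)
  mapsTo : ∀ t ∈ Metric.ball (0 : ℂ) ε, ∀ q ∈ U, Φ t q ∈ Ω
  initial : ∀ q ∈ U, Φ 0 q = q
  ode : ∀ t ∈ Metric.ball (0 : ℂ) ε, ∀ q ∈ U, HasDerivAt (fun s => Φ s q) (Y (Φ t q)) t

/-- The holomorphic vector field `Y` is an infinitesimal symmetry on `Ω` of the web generated by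
`v`: around every point of `Ω` its local flow maps each of the three foliations to itself, i.e. the
differential of the time `t` map sends the direction of `v i` at `q` to the direction of `v i` at
the image of `q`. (The local flow exists and is unique.) -/
def IsInfinitesimalSymmetry (Ω : Set Plane) (v : Fin 3 → Plane → Plane) (Y : Plane → Plane) :
    Prop :=
  ∀ p ∈ Ω, ∃ (U : Set Plane) (ε : ℝ) (Φ : ℂ → Plane → Plane),
    p ∈ U ∧ IsLocalFlow Ω Y U ε Φ ∧
    ∀ t ∈ Metric.ball (0 : ℂ) ε, ∀ q ∈ U, ∀ i,
      fderiv ℂ (Φ t) q (v i q) ∈ Submodule.span ℂ {v i (Φ t q)}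

/-- The direction of `Y` carries an infinitesimal symmetry: around every point of `Ω` some multiple
`f • Y` of `Y` by a nowhere vanishing holomorphic function `f` is an infinitesimal symmetry of the
web generated by `v`. -/
def HasSymmetryAlong (Ω : Set Plane) (v : Fin 3 → Plane → Plane) (Y : Plane → Plane) : Prop :=
  ∀ p ∈ Ω, ∃ (U : Set Plane) (f : Plane → ℂ), IsOpen U ∧ p ∈ U ∧ U ⊆ Ω ∧
    AnalyticOnNhd ℂ f U ∧ (∀ q ∈ U, f q ≠ 0) ∧
    IsInfinitesimalSymmetry U v (fun q => f q • Y q)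

/-- The set of points of `Ω` at which `Y` is transverse to the three foliations generated by `v`. -/
def transversalityLocus (Ω : Set Plane) (v : Fin 3 → Plane → Plane) (Y : Plane → Plane) :
    Set Plane :=
  {p | p ∈ Ω ∧ ∀ i, LinearIndependent ℂ ![Y p, v i p]}

/-!
A 3-web is flat exactly when, around every point, it has an adapted commuting frame: two commuting
fields `u`, `w` such that `u`, `w`, `u + w` are tangent to the three foliations (`isFlatWeb_iff`).
Indeed commuting independent fields are the coordinate fields of a coordinate system, obtained from
the holomorphic Poincaré lemma applied to the dual coframe
(`IsCommutingFrame.exists_rectifying`), and conversely the coordinates that straighten the web pull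
constant fields back to such a frame. The whole argument is carried out with these frames.

*Flatness propagates.* Scale `n₁`, `n₂` so that the web consists of `n₁`, `n₂`, `n₁ + n₂`. Then
`f n₁` and `f n₂` commute if and only if the logarithmic derivative of `f` is the connection form
of the web, so the curvature, which is the exterior derivative of this form, is the obstruction to
flatness. It is analytic, hence on a connected domain a web that is flat on some nonempty open set
is flat everywhere (`isFlatWeb_of_isParallelFrame`). A web that is not flat thus has no adapted
commuting frame on any nonempty open set.

*From a symmetry to flat webs.* If the flow of `Y` preserves the foliations of `a` and `b`, then
`[Y, a]` and `[Y, b]` are parallel to `a` and `b`. Take the multiple `X` of `a` for which `Y + X` is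
parallel to `b`. Then `[Y, X] = [Y, Y + X]` is parallel to both `a` and `b`, hence zero, and `Y`,
`X`, `Y + X` is adapted to the web of `Y`, `a`, `b` (`exists_isParallelFrame_of_bracket`). This
gives the flat webs. It also gives density: if `Y` were tangent to one of the three foliations on an
open set, then the same frame would be adapted to the original web there.

*From flat webs to a symmetry.* Let `u`, `w`, `u + w` be adapted to the web of `v₁`, `v₂`, `Y`, and
let `v₃` be parallel to `u + s w`. The frames of the other two flat webs show that, wherever the
derivative of `s` along `D = u + w` is nonzero, the multiples of `u` and `w` by `(1 - s) / D s` and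
`s (1 - s) / D s` form an adapted commuting frame of the original web; as this web is not flat,
`D s = 0` (`fderiv_slope_eq_zero`). In rectifying coordinates the flow of `D`, a multiple of `Y`,
is a translation, which preserves `u`, `w` and `u + s w` (`isInfinitesimalSymmetry_of_frame`).
-/

open Filter Topology VectorField

/-! ### The holomorphic Poincaré lemma -/

section Primitive

variable {E F : Type*} [NormedAddCommGroup E] [NormedSpace ℂ E] [NormedAddCommGroup F]
  [NormedSpace ℂ F]

/-- The formal power series obtained by integrating the power series `p` of a 1-form along rays
through the centre. -/
noncomputable def radialPrimitive (p : FormalMultilinearSeries ℂ E (E →L[ℂ] F)) :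
    FormalMultilinearSeries ℂ E F :=
  fun n => (n : ℂ)⁻¹ • p.unshift 0 n

theorem radius_le_radius_radialPrimitive (p : FormalMultilinearSeries ℂ E (E →L[ℂ] F)) :
    p.radius ≤ (radialPrimitive p).radius := by
  rw [← p.radius_unshift 0]
  refine FormalMultilinearSeries.radius_le_of_le fun n => ?_
  rw [radialPrimitive, norm_smul, norm_inv, Complex.norm_natCast]
  refine mul_le_of_le_one_left (norm_nonneg _) ?_
  rcases n with _ | n
  · simp
  · exact inv_le_one_of_one_le₀ (by push_cast; linarith [n.cast_nonneg (α := ℝ)])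

theorem radialPrimitive_succ_apply (p : FormalMultilinearSeries ℂ E (E →L[ℂ] F)) (n : ℕ) (y : E) :
    (n + 1) • radialPrimitive p (n + 1) (fun _ => y) = p n (fun _ => y) y := by
  have : ((n : ℂ) + 1) ≠ 0 := by exact_mod_cast Nat.succ_ne_zero n
  have h : radialPrimitive p (n + 1) (fun _ => y) = ((n : ℂ) + 1)⁻¹ • p n (fun _ => y) y := by
    unfold radialPrimitive
    push_cast
    rfl
  rw [h, ← Nat.cast_smul_eq_nsmul ℂ]
  push_cast
  rw [smul_smul, mul_inv_cancel₀ this, one_smul]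

/-- A primitive of a 1-form that is analytic at a point is itself analytic there: its power series
is obtained by integrating that of the form along rays. -/
theorem analyticAt_of_hasFDerivAt [CompleteSpace F] {ω : E → E →L[ℂ] F} {f : E → F} {a : E}
    (hω : AnalyticAt ℂ ω a) (hf : ∀ᶠ x in 𝓝 a, HasFDerivAt f (ω x) x) : AnalyticAt ℂ f a := by
  obtain ⟨p, R, hp⟩ := hω
  set q := radialPrimitive p with hq
  have hRq : R ≤ q.radius := hp.r_le.trans (radius_le_radius_radialPrimitive p)
  have hF₀ : HasFPowerSeriesOnBall q.sum q 0 R :=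
    (q.hasFPowerSeriesOnBall (hp.r_pos.trans_le hRq)).mono hp.r_pos hRq
  have hF : HasFPowerSeriesOnBall (fun x => q.sum (x - a)) q a R := by
    simpa using hF₀.comp_sub a
  -- the radial derivative of the integrated series is that of the form
  have hrad : ∀ y : E, y ∈ Metric.eball (0 : E) R →
      fderiv ℂ (fun x => q.sum (x - a)) (a + y) y = ω (a + y) y := by
    intro y hy
    have h1 := (hF.fderiv.hasSum hy).mapL (ContinuousLinearMap.apply ℂ F y)
    have h2 := (hp.hasSum hy).mapL (ContinuousLinearMap.apply ℂ F y)
    simp only [ContinuousLinearMap.apply_apply, FormalMultilinearSeries.derivSeries_apply_diag, hq,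
      radialPrimitive_succ_apply] at h1 h2
    exact h1.unique h2
  have hzero : fderiv ℂ (fun x => q.sum (x - a)) a = ω a := by
    rw [hF.hasFPowerSeriesAt.fderiv_eq]
    ext y
    have := radialPrimitive_succ_apply p 0 y
    simp only [zero_add, one_smul] at this
    have h0 := hp.coeff_zero (fun _ => y)
    rw [← h0, ← this]
    rfl
  obtain ⟨δ, hδ, hball⟩ := Metric.eventually_nhds_iff_ball.1 hf
  obtain ⟨ε, hε, hεR⟩ : ∃ ε : ℝ, 0 < ε ∧ ENNReal.ofReal ε ≤ R := by
    rcases ENNReal.lt_iff_exists_nnreal_btwn.1 hp.r_pos with ⟨r, hr0, hr⟩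
    exact ⟨r, by simpa using hr0, by simpa using hr.le⟩
  refine (hF.analyticAt.add (analyticAt_const (v := f a - q.sum 0))).congr ?_
  filter_upwards [Metric.ball_mem_nhds a (lt_min hδ hε)] with x hx
  set y := x - a with hy
  have hyn : ‖y‖ < min δ ε := by simpa [hy, dist_eq_norm] using hx
  -- both sides have the same derivative along the segment from `a` to `x`
  have hseg : ∀ t ∈ Icc (0 : ℝ) 1, ‖(t : ℂ) • y‖ < min δ ε := by
    intro t ht
    rw [norm_smul, Complex.norm_real, Real.norm_of_nonneg ht.1]
    exact (mul_le_of_le_one_left (norm_nonneg _) ht.2).trans_lt hyn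
  have hR : ∀ t ∈ Icc (0 : ℝ) 1, (t : ℂ) • y ∈ Metric.eball (0 : E) R := by
    intro t ht
    have h1 := (hseg t ht).trans_le (min_le_right _ _)
    refine Metric.eball_subset_eball hεR ?_
    rw [Metric.eball_ofReal]
    simpa using h1
  have hline : ∀ t : ℝ, HasDerivAt (fun t : ℝ => a + (t : ℂ) • y) y t := by
    intro t
    have := ((Complex.ofRealCLM.hasDerivAt (x := t)).smul_const y).const_add a
    simpa using this
  have hderiv : ∀ t ∈ Icc (0 : ℝ) 1, HasDerivAt
      (fun t : ℝ => f (a + (t : ℂ) • y) - q.sum (a + (t : ℂ) • y - a)) 0 t := by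
    intro t ht
    have h1 : HasFDerivAt f (ω (a + (t : ℂ) • y)) (a + (t : ℂ) • y) := hball _ (by
      have := (hseg t ht).trans_le (min_le_left _ _)
      simpa [dist_eq_norm] using this)
    have h2 : HasFDerivAt (fun x => q.sum (x - a))
        (fderiv ℂ (fun x => q.sum (x - a)) (a + (t : ℂ) • y)) (a + (t : ℂ) • y) := by
      refine (hF.analyticAt_of_mem ?_).differentiableAt.hasFDerivAt
      simpa [Metric.mem_eball, edist_eq_enorm_sub] using hR t ht
    have h3 := ((h1.sub h2).restrictScalars ℝ).comp_hasDerivAt t (hline t)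
    have : fderiv ℂ (fun x => q.sum (x - a)) (a + (t : ℂ) • y) y = ω (a + (t : ℂ) • y) y := by
      rcases eq_or_ne t 0 with rfl | h0
      · simp [hzero]
      · have h4 := hrad _ (hR t ht)
        rw [map_smul, map_smul] at h4
        exact smul_right_injective F (by exact_mod_cast h0 : (t : ℂ) ≠ 0) h4
    have h5 : (0 : F) = (ω (a + (t : ℂ) • y) -
        fderiv ℂ (fun x => q.sum (x - a)) (a + (t : ℂ) • y)) y := by
      simp only [sub_apply, this, sub_self]
    rw [h5]
    exact h3
  have := constant_of_has_deriv_right_zero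
    (fun t ht => (hderiv t ht).continuousAt.continuousWithinAt)
    (fun t ht => (hderiv t ⟨ht.1, ht.2.le⟩).hasDerivWithinAt) 1 (by simp)
  simp only [Complex.ofReal_one, one_smul, Complex.ofReal_zero, zero_smul, add_zero,
    add_sub_cancel_left, sub_self] at this
  have hxa : a + y = x := by simp [hy]
  rw [hxa] at this
  simp only [Pi.add_apply]
  rw [← this]
  abel

/-- **Holomorphic Poincaré lemma**: near each point, a closed analytic 1-form has an analytic
primitive. -/
theorem exists_analytic_primitive [CompleteSpace F] {ω : E → E →L[ℂ] F} {V : Set E}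
    (hV : IsOpen V) (hω : AnalyticOnNhd ℂ ω V)
    (hsymm : ∀ x ∈ V, ∀ y z, fderiv ℂ ω x y z = fderiv ℂ ω x z y) {a : E} (ha : a ∈ V) :
    ∃ (W : Set E) (f : E → F), IsOpen W ∧ a ∈ W ∧ W ⊆ V ∧ AnalyticOnNhd ℂ f W ∧
      ∀ x ∈ W, HasFDerivAt f (ω x) x := by
  obtain ⟨δ, hδ, hball⟩ := Metric.isOpen_iff.1 hV a ha
  let _ : NormedSpace ℝ E := NormedSpace.restrictScalars ℝ ℂ E
  let _ : NormedSpace ℝ F := NormedSpace.restrictScalars ℝ ℂ F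
  obtain ⟨f, hf⟩ := (convex_ball a δ).exists_forall_hasFDerivAt_of_fderiv_symmetric (𝕜 := ℂ)
    (ω := ω) Metric.isOpen_ball
    (fun x hx => ((hω x (hball hx)).differentiableAt.restrictScalars ℝ).differentiableWithinAt)
    (fun x hx y z => by
      have h := ((hω x (hball hx)).differentiableAt.hasFDerivAt.restrictScalars ℝ).fderiv
      simpa [h] using hsymm x (hball hx) y z)
  exact ⟨_, f, Metric.isOpen_ball, Metric.mem_ball_self hδ, hball,
    fun x hx => analyticAt_of_hasFDerivAt (hω x (hball hx))
      (mem_of_superset (Metric.isOpen_ball.mem_nhds hx) hf), hf⟩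

end Primitive

/-! ### The area form of the plane -/

/-- The area form of the plane: the determinant of two vectors, as a continuous bilinear form. -/
noncomputable def area : Plane →L[ℂ] Plane →L[ℂ] ℂ :=
  (ContinuousLinearMap.fst ℂ ℂ ℂ).smulRight (ContinuousLinearMap.snd ℂ ℂ ℂ) -
    (ContinuousLinearMap.snd ℂ ℂ ℂ).smulRight (ContinuousLinearMap.fst ℂ ℂ ℂ)

theorem area_apply (a b : Plane) : area a b = a.1 * b.2 - a.2 * b.1 := by
  simp [area]

theorem area_swap (a b : Plane) : area a b = -area b a := by
  simp only [area_apply]; ring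

@[simp] theorem area_self (a : Plane) : area a a = 0 := by
  simp only [area_apply]; ring

theorem area_eq_zero_comm {a b : Plane} : area a b = 0 ↔ area b a = 0 := by
  rw [area_swap a b, neg_eq_zero]

/-- Cramer's rule. -/
theorem eq_area_smul_add (x : Plane) {a b : Plane} (h : area a b ≠ 0) :
    x = (area x b / area a b) • a + (area a x / area a b) • b := by
  ext <;> simp only [Prod.fst_add, Prod.snd_add, Prod.smul_fst, Prod.smul_snd, smul_eq_mul] <;>
    field_simp <;> simp only [area_apply] <;> ring

theorem eq_zero_of_area_eq_zero {x a b : Plane} (h : area a b ≠ 0) (ha : area a x = 0)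
    (hb : area x b = 0) : x = 0 := by
  rw [eq_area_smul_add x h, ha, hb]; simp

/-- A vector parallel to `c` is a multiple of `c`, with the coefficient read off by means of any
vector `a` transverse to `c`. -/
theorem eq_area_smul {x a c : Plane} (h : area a c ≠ 0) (hx : area x c = 0) :
    x = (area a x / area a c) • c := by
  conv_lhs => rw [eq_area_smul_add x h, hx]
  simp

theorem linearIndependent_pair_iff_area {a b : Plane} :
    LinearIndependent ℂ ![a, b] ↔ area a b ≠ 0 := by
  rw [LinearIndependent.pair_iff]
  constructor
  · intro h h0
    rw [area_apply] at h0
    have h1 := h b.2 (-a.2) (by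
      ext <;> simp only [Prod.fst_add, Prod.snd_add, Prod.smul_fst, Prod.smul_snd, smul_eq_mul,
        Prod.fst_zero, Prod.snd_zero]
      exacts [by linear_combination h0, by ring])
    have h2 := h b.1 (-a.1) (by
      ext <;> simp only [Prod.fst_add, Prod.snd_add, Prod.smul_fst, Prod.smul_snd, smul_eq_mul,
        Prod.fst_zero, Prod.snd_zero]
      exacts [by ring, by linear_combination -h0])
    have ha : a = 0 := Prod.ext (by simpa using h2.2) (by simpa using h1.2)
    have := h 1 0 (by simp [ha])
    simp at this
  · intro h s t hst
    have h1 : area (s • a + t • b) b = 0 := by rw [hst]; simp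
    have h2 : area a (s • a + t • b) = 0 := by rw [hst]; simp
    simp only [map_add, map_smul, add_apply, smul_apply,
      area_self, smul_eq_mul, mul_zero, add_zero, zero_add, mul_eq_zero, h, or_false] at h1 h2
    exact ⟨h1, h2⟩

theorem mem_span_singleton_iff_area {x c : Plane} (hc : c ≠ 0) :
    x ∈ Submodule.span ℂ {c} ↔ area x c = 0 := by
  constructor
  · intro h
    obtain ⟨k, rfl⟩ := Submodule.mem_span_singleton.1 h
    simp
  · intro h
    by_contra hx
    have : ∃ a : Plane, area a c ≠ 0 := by
      by_contra! h'
      refine hc (Prod.ext ?_ ?_)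
      · simpa [area_apply] using h' (0, 1)
      · simpa [area_apply] using h' (1, 0)
    obtain ⟨a, ha⟩ := this
    exact hx (Submodule.mem_span_singleton.2 ⟨_, (eq_area_smul ha h).symm⟩)

theorem area_eq_zero_of_mem_span {x c : Plane} (h : x ∈ Submodule.span ℂ {c}) :
    area x c = 0 := by
  obtain ⟨k, rfl⟩ := Submodule.mem_span_singleton.1 h
  simp

theorem left_ne_zero_of_area {a b : Plane} (h : area a b ≠ 0) : a ≠ 0 := by
  rintro rfl; simp at h

theorem right_ne_zero_of_area {a b : Plane} (h : area a b ≠ 0) : b ≠ 0 := by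
  rintro rfl; simp at h

theorem area_map (M : Plane →L[ℂ] Plane) (x y : Plane) :
    area (M x) (M y) = area (M (1, 0)) (M (0, 1)) * area x y := by
  have h : ∀ z : Plane, M z = z.1 • M (1, 0) + z.2 • M (0, 1) := by
    intro z
    rw [← map_smul, ← map_smul, ← map_add]
    congr 1
    ext <;> simp
  rw [h x, h y]
  simp only [area_apply, Prod.fst_add, Prod.snd_add, Prod.smul_fst, Prod.smul_snd, smul_eq_mul]
  ring

theorem area_map_eq_zero_iff {M : Plane →L[ℂ] Plane} (hM : Function.Injective M) {x y : Plane} :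
    area (M x) (M y) = 0 ↔ area x y = 0 := by
  have : area (M (1, 0)) (M (0, 1)) ≠ 0 := by
    rw [← linearIndependent_pair_iff_area, LinearIndependent.pair_iff]
    intro s t hst
    rw [← map_smul, ← map_smul, ← map_add, map_eq_zero_iff M hM] at hst
    simpa using hst
  rw [area_map, mul_eq_zero, or_iff_right this]

theorem analyticAt_area {E : Type*} [NormedAddCommGroup E] [NormedSpace ℂ E] {a b : E → Plane}
    {p : E} (ha : AnalyticAt ℂ a p) (hb : AnalyticAt ℂ b p) :
    AnalyticAt ℂ (fun q => area (a q) (b q)) p := by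
  simp only [area_apply]
  exact ((analyticAt_fst.comp ha).mul (analyticAt_snd.comp hb)).sub
    ((analyticAt_snd.comp ha).mul (analyticAt_fst.comp hb))

/-- A bilinear map on the plane is symmetric as soon as it is so on a basis. -/
theorem bilin_symm_of_basis {F : Type*} [NormedAddCommGroup F] [NormedSpace ℂ F]
    (B : Plane →L[ℂ] Plane →L[ℂ] F) {a b : Plane} (h : area a b ≠ 0) (hab : B a b = B b a)
    (x y : Plane) : B x y = B y x := by
  rw [eq_area_smul_add x h, eq_area_smul_add y h]
  simp only [map_add, map_smul, add_apply, smul_apply, hab]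
  module

/-! ### Commuting frames and rectification -/

/-- Two commuting analytic vector fields that span the tangent plane at every point of `V`. -/
structure IsCommutingFrame (V : Set Plane) (u w : Plane → Plane) : Prop where
  left : AnalyticOnNhd ℂ u V
  right : AnalyticOnNhd ℂ w V
  transverse : ∀ q ∈ V, area (u q) (w q) ≠ 0
  bracket : ∀ q ∈ V, lieBracket ℂ u w q = 0

/-- The coframe dual to the frame `u`, `w`: the two coordinates of a vector in this frame. -/
noncomputable def coframe (u w : Plane → Plane) (q : Plane) : Plane →L[ℂ] Plane :=
  (area (u q) (w q))⁻¹ • (-area (w q)).prod (area (u q))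

theorem coframe_left {u w : Plane → Plane} {q : Plane} (h : area (u q) (w q) ≠ 0) :
    coframe u w q (u q) = (1, 0) := by
  have : -area (w q) (u q) = area (u q) (w q) := by rw [area_swap (w q), neg_neg]
  simp [coframe, this, h]

theorem coframe_right {u w : Plane → Plane} {q : Plane} (h : area (u q) (w q) ≠ 0) :
    coframe u w q (w q) = (0, 1) := by
  simp [coframe, h]

theorem analyticAt_coframe {u w : Plane → Plane} {q : Plane} (hu : AnalyticAt ℂ u q)
    (hw : AnalyticAt ℂ w q) (h : area (u q) (w q) ≠ 0) : AnalyticAt ℂ (coframe u w) q := by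
  refine ((analyticAt_area hu hw).inv h).smul ?_
  have h1 : AnalyticAt ℂ (fun q => (-area (w q), area (u q))) q :=
    (((area.analyticAt _).comp hw).neg).prod ((area.analyticAt _).comp hu)
  exact ((ContinuousLinearMap.prodₗᵢ (E := Plane) (F := ℂ) (G := ℂ) (𝕜 := ℂ)
    ℂ).toContinuousLinearEquiv.toContinuousLinearMap.analyticAt _).comp h1

/-- The coframe dual to a frame identifies the tangent plane with `ℂ × ℂ`. -/
noncomputable def coframeEquiv {u w : Plane → Plane} {q : Plane} (h : area (u q) (w q) ≠ 0) :
    Plane ≃L[ℂ] Plane :=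
  ContinuousLinearEquiv.equivOfInverse (coframe u w q)
    ((ContinuousLinearMap.fst ℂ ℂ ℂ).smulRight (u q) +
      (ContinuousLinearMap.snd ℂ ℂ ℂ).smulRight (w q))
    (fun x => by
      conv_rhs => rw [eq_area_smul_add x h]
      simp only [coframe, add_apply, ContinuousLinearMap.smulRight_apply, smul_apply,
        ContinuousLinearMap.prod_apply, ContinuousLinearMap.coe_fst',
        ContinuousLinearMap.coe_snd', Prod.smul_fst, Prod.smul_snd, smul_eq_mul,
        neg_apply, ← area_swap x (w q)]
      rw [div_eq_inv_mul, div_eq_inv_mul])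
    (fun x => by
      simp [coframe_left h, coframe_right h])

/-- The coframe dual to a commuting frame is closed. -/
theorem IsCommutingFrame.fderiv_coframe_symm {V : Set Plane} {u w : Plane → Plane} (hV : IsOpen V)
    (h : IsCommutingFrame V u w) {q : Plane} (hq : q ∈ V) (x y : Plane) :
    fderiv ℂ (coframe u w) q x y = fderiv ℂ (coframe u w) q y x := by
  have hη := (analyticAt_coframe (h.left q hq) (h.right q hq) (h.transverse q hq)).differentiableAt
  have key : ∀ (z : Plane → Plane) (c : Plane), DifferentiableAt ℂ z q →
      (∀ p ∈ V, coframe u w p (z p) = c) → ∀ x,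
      fderiv ℂ (coframe u w) q x (z q) = -coframe u w q (fderiv ℂ z q x) := by
    intro z c hz hc x
    have h1 := hη.hasFDerivAt.clm_apply hz.hasFDerivAt
    have h2 : (fun p => coframe u w p (z p)) =ᶠ[𝓝 q] fun _ => c :=
      mem_of_superset (hV.mem_nhds hq) hc
    have h3 := h1.unique ((hasFDerivAt_const c q).congr_of_eventuallyEq h2)
    have h4 := congrArg (fun L : Plane →L[ℂ] Plane => L x) h3
    simp only [add_apply, ContinuousLinearMap.comp_apply, ContinuousLinearMap.flip_apply,
      zero_apply] at h4
    exact eq_neg_of_add_eq_zero_right h4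
  refine bilin_symm_of_basis _ (h.transverse q hq) ?_ x y
  rw [key w _ (h.right q hq).differentiableAt
      (fun p hp => coframe_right (h.transverse p hp)) (u q),
    key u _ (h.left q hq).differentiableAt
      (fun p hp => coframe_left (h.transverse p hp)) (w q), neg_inj, ← sub_eq_zero, ← map_sub]
  have := h.bracket q hq
  rw [lieBracket] at this
  rw [this, map_zero]

/-- **Simultaneous rectification**: two commuting independent fields are the coordinate fields of
a local coordinate system, which is obtained by integrating the dual coframe. -/
theorem IsCommutingFrame.exists_rectifying {V : Set Plane} {u w : Plane → Plane} (hV : IsOpen V)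
    (h : IsCommutingFrame V u w) {p : Plane} (hp : p ∈ V) :
    ∃ φ : OpenPartialHomeomorph Plane Plane, p ∈ φ.source ∧ φ.source ⊆ V ∧
      AnalyticOnNhd ℂ φ φ.source ∧ AnalyticOnNhd ℂ φ.symm φ.target ∧
      ∀ q ∈ φ.source, fderiv ℂ φ q (u q) = (1, 0) ∧ fderiv ℂ φ q (w q) = (0, 1) := by
  obtain ⟨W, f, hW, hpW, hWV, hf, hfη⟩ := exists_analytic_primitive hV
    (fun q hq => analyticAt_coframe (h.left q hq) (h.right q hq) (h.transverse q hq))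
    (fun q hq => h.fderiv_coframe_symm hV hq) hp
  have hstrict : HasStrictFDerivAt f (coframeEquiv (h.transverse p hp) : Plane →L[ℂ] Plane) p := by
    have h1 := (hf p hpW).hasStrictFDerivAt
    rw [(hfη p hpW).fderiv] at h1
    exact h1
  let R := hstrict.toOpenPartialHomeomorph f
  let φ := R.restrOpen W hW
  have hφ : ⇑φ = f := rfl
  have hsource : φ.source ⊆ W := fun q hq => by
    rw [OpenPartialHomeomorph.restrOpen_source] at hq
    exact hq.2
  refine ⟨φ, ?_, hsource.trans hWV, ?_, ?_, ?_⟩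
  · rw [OpenPartialHomeomorph.restrOpen_source]
    exact ⟨hstrict.mem_toOpenPartialHomeomorph_source, hpW⟩
  · intro q hq
    rw [hφ]
    exact hf q (hsource hq)
  · intro z hz
    have hq : φ.symm z ∈ φ.source := φ.map_target hz
    refine φ.analyticAt_symm (i := coframeEquiv (h.transverse _ (hWV (hsource hq)))) hz ?_ ?_
    · rw [hφ]
      exact hf _ (hsource hq)
    · rw [hφ]
      exact (hfη _ (hsource hq)).fderiv
  · intro q hq
    rw [hφ, (hfη q (hsource hq)).fderiv]
    exact ⟨coframe_left (h.transverse _ (hWV (hsource hq))),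
      coframe_right (h.transverse _ (hWV (hsource hq)))⟩

/-! ### Flat webs and adapted frames -/

/-- A commuting frame `u`, `w` on `V` adapted to the web of `a`, `b`, `c`: the fields `u`, `w` and
`u + w` are multiples of `a`, `b` and `c`. -/
structure IsParallelFrame (V : Set Plane) (a b c u w : Plane → Plane) : Prop extends
    IsCommutingFrame V u w where
  area_left : ∀ q ∈ V, area (u q) (a q) = 0
  area_right : ∀ q ∈ V, area (w q) (b q) = 0
  area_add : ∀ q ∈ V, area (u q + w q) (c q) = 0

theorem IsCommutingFrame.mono {V W : Set Plane} {u w : Plane → Plane}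
    (h : IsCommutingFrame V u w) (hWV : W ⊆ V) : IsCommutingFrame W u w :=
  ⟨h.left.mono hWV, h.right.mono hWV, fun q hq => h.transverse q (hWV hq),
    fun q hq => h.bracket q (hWV hq)⟩

theorem IsParallelFrame.mono {V W : Set Plane} {a b c u w : Plane → Plane}
    (h : IsParallelFrame V a b c u w) (hWV : W ⊆ V) : IsParallelFrame W a b c u w :=
  ⟨h.toIsCommutingFrame.mono hWV, fun q hq => h.area_left q (hWV hq),
    fun q hq => h.area_right q (hWV hq), fun q hq => h.area_add q (hWV hq)⟩

theorem isWeb_iff {Ω : Set Plane} {a b c : Plane → Plane} :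
    IsWeb Ω ![a, b, c] ↔
      (AnalyticOnNhd ℂ a Ω ∧ AnalyticOnNhd ℂ b Ω ∧ AnalyticOnNhd ℂ c Ω) ∧
      (∀ p ∈ Ω, area (a p) (b p) ≠ 0) ∧ (∀ p ∈ Ω, area (b p) (c p) ≠ 0) ∧
      (∀ p ∈ Ω, area (a p) (c p) ≠ 0) := by
  constructor
  · intro h
    exact ⟨⟨h.holomorphic 0, h.holomorphic 1, h.holomorphic 2⟩,
      fun p hp => linearIndependent_pair_iff_area.1 (h.transverse 0 1 (by decide) p hp),
      fun p hp => linearIndependent_pair_iff_area.1 (h.transverse 1 2 (by decide) p hp),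
      fun p hp => linearIndependent_pair_iff_area.1 (h.transverse 0 2 (by decide) p hp)⟩
  · rintro ⟨⟨ha, hb, hc⟩, hab, hbc, hac⟩
    refine ⟨fun i => ?_, fun i j hij p hp => linearIndependent_pair_iff_area.2 ?_⟩
    · fin_cases i
      exacts [ha, hb, hc]
    · have h1 := hab p hp
      have h2 := hbc p hp
      have h3 := hac p hp
      have h4 := h1
      have h5 := h2
      have h6 := h3
      rw [area_swap, neg_ne_zero] at h4 h5 h6
      fin_cases i <;> fin_cases j <;> first | exact absurd rfl hij | assumption

theorem fderiv_symm_comp_fderiv (φ : OpenPartialHomeomorph Plane Plane)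
    (hφ : AnalyticOnNhd ℂ φ φ.source) (hφs : AnalyticOnNhd ℂ φ.symm φ.target) {q : Plane}
    (hq : q ∈ φ.source) :
    (fderiv ℂ φ.symm (φ q)).comp (fderiv ℂ φ q) = ContinuousLinearMap.id ℂ Plane :=
  ((hφs _ (φ.map_source hq)).differentiableAt.hasFDerivAt.comp q
    (hφ q hq).differentiableAt.hasFDerivAt).unique ((hasFDerivAt_id q).congr_of_eventuallyEq
      (mem_of_superset (φ.open_source.mem_nhds hq) fun _ hz => φ.left_inv hz))

/-- Flatness in terms of adapted commuting frames: the web is flat exactly when such a frame exists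
around every point. -/
theorem isFlatWeb_iff {Ω : Set Plane} {a b c : Plane → Plane}
    (hweb : IsWeb Ω ![a, b, c]) :
    IsFlatWeb Ω ![a, b, c] ↔ ∀ p ∈ Ω, ∃ (V : Set Plane) (u w : Plane → Plane),
      IsOpen V ∧ p ∈ V ∧ V ⊆ Ω ∧ IsParallelFrame V a b c u w := by
  constructor
  · rintro ⟨-, h⟩ p hp
    obtain ⟨φ, hpφ, hφΩ, hφ, hφs, m, hm⟩ := h p hp
    obtain ⟨-, hab, hbc, hac⟩ := isWeb_iff.1 hweb
    have hinv : ∀ q ∈ φ.source, (fderiv ℂ φ q).IsInvertible := by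
      intro q hq
      have e1 := fderiv_symm_comp_fderiv φ hφ hφs hq
      have e2 := fderiv_symm_comp_fderiv φ.symm hφs hφ (φ.map_source hq)
      rw [φ.symm_symm, φ.left_inv hq] at e2
      exact ContinuousLinearMap.IsInvertible.of_inverse e2 e1
    have hinj : ∀ q ∈ φ.source, Function.Injective (fderiv ℂ φ q) :=
      fun q hq => (hinv q hq).injective
    have hma : ∀ q ∈ φ.source, fderiv ℂ φ q (a q) ∈ Submodule.span ℂ {m 0} := hm 0
    have hmb : ∀ q ∈ φ.source, fderiv ℂ φ q (b q) ∈ Submodule.span ℂ {m 1} := hm 1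
    have hmc : ∀ q ∈ φ.source, fderiv ℂ φ q (c q) ∈ Submodule.span ℂ {m 2} := hm 2
    have hmm : area (m 0) (m 1) ≠ 0 ∧ area (m 2) (m 1) ≠ 0 ∧ area (m 0) (m 2) ≠ 0 := by
      obtain ⟨ka, hka⟩ := Submodule.mem_span_singleton.1 (hma p hpφ)
      obtain ⟨kb, hkb⟩ := Submodule.mem_span_singleton.1 (hmb p hpφ)
      obtain ⟨kc, hkc⟩ := Submodule.mem_span_singleton.1 (hmc p hpφ)
      have h1 := mt (area_map_eq_zero_iff (hinj p hpφ)).1 (hab p hp)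
      have h2 := mt (area_map_eq_zero_iff (hinj p hpφ)).1 (mt area_eq_zero_comm.1 (hbc p hp))
      have h3 := mt (area_map_eq_zero_iff (hinj p hpφ)).1 (hac p hp)
      rw [← hka, ← hkb] at h1
      rw [← hkc, ← hkb] at h2
      rw [← hka, ← hkc] at h3
      simp only [map_smul, smul_apply, smul_eq_mul, mul_eq_zero, not_or] at h1 h2 h3
      exact ⟨h1.2.2, h2.2.2, h3.2.2⟩
    set A : Plane := (area (m 2) (m 1) / area (m 0) (m 1)) • m 0 with hA
    set B : Plane := (area (m 0) (m 2) / area (m 0) (m 1)) • m 1 with hB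
    have hAB : A + B = m 2 := (eq_area_smul_add (m 2) hmm.1).symm
    -- the frame is the pullback of a constant one
    have hpull : ∀ (z : Plane), ∀ q ∈ φ.source,
        fderiv ℂ φ q (pullback ℂ φ (fun _ => z) q) = z := by
      intro z q hq
      exact (hinv q hq).self_apply_inverse z
    have han : ∀ z : Plane, AnalyticOnNhd ℂ (pullback ℂ φ (fun _ => z)) φ.source := by
      intro z q hq
      obtain ⟨e, he⟩ := hinv q hq
      have h1 : AnalyticAt ℂ (ContinuousLinearMap.inverse : (Plane →L[ℂ] Plane) → _)
          (fderiv ℂ φ q) := by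
        rw [← he]
        exact (contDiffAt_map_inverse e).analyticAt
      have h2 := h1.comp (hφ q hq).fderiv
      exact ((ContinuousLinearMap.apply ℂ Plane z).analyticAt _).comp h2
    refine ⟨φ.source, pullback ℂ φ (fun _ => A), pullback ℂ φ (fun _ => B), φ.open_source, hpφ,
      hφΩ, ⟨han A, han B, ?_, ?_⟩, ?_, ?_, ?_⟩
    · intro q hq
      rw [ne_eq, ← area_map_eq_zero_iff (hinj q hq), hpull A q hq, hpull B q hq]
      simp [hA, hB, hmm]
    · intro q hq
      rw [← pullback_lieBracket (n := ⊤) le_top (hφ q hq).contDiffAt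
        (differentiableAt_const A) (differentiableAt_const B)]
      simp [pullback, lieBracket]
    · intro q hq
      obtain ⟨k, hk⟩ := Submodule.mem_span_singleton.1 (hma q hq)
      rw [← area_map_eq_zero_iff (hinj q hq), hpull A q hq, ← hk]
      simp [hA]
    · intro q hq
      obtain ⟨k, hk⟩ := Submodule.mem_span_singleton.1 (hmb q hq)
      rw [← area_map_eq_zero_iff (hinj q hq), hpull B q hq, ← hk]
      simp [hB]
    · intro q hq
      obtain ⟨k, hk⟩ := Submodule.mem_span_singleton.1 (hmc q hq)
      rw [← area_map_eq_zero_iff (hinj q hq), map_add, hpull A q hq, hpull B q hq, hAB, ← hk]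
      simp
  · intro h
    refine ⟨hweb, fun p hp => ?_⟩
    obtain ⟨V, u, w, hV, hpV, hVΩ, hf⟩ := h p hp
    obtain ⟨φ, hpφ, hφV, hφ, hφs, hφuw⟩ := hf.toIsCommutingFrame.exists_rectifying hV hpV
    refine ⟨φ, hpφ, hφV.trans hVΩ, hφ, hφs, ![(1, 0), (0, 1), (1, 1)], fun i q hq => ?_⟩
    have hpar : ∀ x y : Plane, x ≠ 0 → area x y = 0 →
        fderiv ℂ φ q y ∈ Submodule.span ℂ {fderiv ℂ φ q x} := by
      intro x y hx hxy
      obtain ⟨k, rfl⟩ := Submodule.mem_span_singleton.1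
        ((mem_span_singleton_iff_area hx).2 (area_eq_zero_comm.1 hxy))
      rw [map_smul]
      exact Submodule.smul_mem _ _ (Submodule.mem_span_singleton_self _)
    have hq' := hφV hq
    have ht := hf.transverse q hq'
    fin_cases i
    · have := hpar _ _ (left_ne_zero_of_area ht) (hf.area_left q hq')
      rwa [(hφuw q hq).1] at this
    · have := hpar _ _ (right_ne_zero_of_area ht) (hf.area_right q hq')
      rwa [(hφuw q hq).2] at this
    · have hne : u q + w q ≠ 0 := by
        intro h0
        apply ht
        have : area (u q) (u q + w q) = 0 := by rw [h0, map_zero]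
        simpa using this
      have := hpar _ _ hne (hf.area_add q hq')
      rw [map_add, (hφuw q hq).1, (hφuw q hq).2] at this
      simpa using this

/-! ### Lie brackets and webs adapted to commuting frames -/

theorem area_eq_zero_trans {x a b : Plane} (ha : a ≠ 0) (hxa : area x a = 0)
    (hab : area a b = 0) : area x b = 0 := by
  obtain ⟨k, rfl⟩ := Submodule.mem_span_singleton.1 ((mem_span_singleton_iff_area ha).2 hxa)
  simp [hab]

theorem IsParallelFrame.swap {V : Set Plane} {a b c u w : Plane → Plane}
    (h : IsParallelFrame V a b c u w) : IsParallelFrame V b a c w u where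
  left := h.right
  right := h.left
  transverse q hq := mt area_eq_zero_comm.1 (h.transverse q hq)
  bracket q hq := by rw [lieBracket_swap, h.bracket q hq, neg_zero]
  area_left := h.area_right
  area_right := h.area_left
  area_add q hq := by rw [add_comm]; exact h.area_add q hq

/-- If `u`, `w`, `u + w` are adapted to `a`, `b`, `c`, then `-u`, `u + w` and their sum `w` are
adapted to `a`, `c`, `b`. -/
theorem IsParallelFrame.rotate {V : Set Plane} {a b c u w : Plane → Plane}
    (h : IsParallelFrame V a b c u w) : IsParallelFrame V a c b (-u) (u + w) where
  left := h.left.neg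
  right := h.left.add h.right
  transverse q hq := by simpa using h.transverse q hq
  bracket q hq := by
    have hu := (h.left q hq).differentiableAt
    have hw := (h.right q hq).differentiableAt
    rw [lieBracket_add_right hu hw]
    have e : -u = (-1 : ℂ) • u := by simp
    rw [e, lieBracket_const_smul_left hu, lieBracket_const_smul_left hu, h.bracket q hq]
    simp
  area_left q hq := by simpa using h.area_left q hq
  area_right := h.area_add
  area_add q hq := by simpa using h.area_right q hq

theorem IsParallelFrame.congr_left {V : Set Plane} {a b c u w a' : Plane → Plane}
    (h : IsParallelFrame V a b c u w) (ha : ∀ q ∈ V, a q ≠ 0)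
    (haa' : ∀ q ∈ V, area (a q) (a' q) = 0) : IsParallelFrame V a' b c u w :=
  { h with area_left := fun q hq => area_eq_zero_trans (ha q hq) (h.area_left q hq) (haa' q hq) }

theorem lieBracket_smul_smul {f g : Plane → ℂ} {a b : Plane → Plane} {q : Plane}
    (hf : DifferentiableAt ℂ f q) (hg : DifferentiableAt ℂ g q) (ha : DifferentiableAt ℂ a q)
    (hb : DifferentiableAt ℂ b q) :
    lieBracket ℂ (fun p => f p • a p) (fun p => g p • b p) q =
      (f q * fderiv ℂ g q (a q)) • b q - (g q * fderiv ℂ f q (b q)) • a q +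
        (f q * g q) • lieBracket ℂ a b q := by
  rw [lieBracket_smul_right hg hb, lieBracket_smul_left hf ha, map_smul]
  simp only [smul_eq_mul]
  module

theorem analyticAt_fderiv_apply {E F : Type*} [NormedAddCommGroup E] [NormedSpace ℂ E]
    [NormedAddCommGroup F] [NormedSpace ℂ F] [CompleteSpace E] [CompleteSpace F] {f : E → F}
    {a : E → E} {q : E} (hf : AnalyticAt ℂ f q) (ha : AnalyticAt ℂ a q) :
    AnalyticAt ℂ (fun p => fderiv ℂ f p (a p)) q :=
  (hf.fderiv.contDiffAt.clm_apply ha.contDiffAt).analyticAt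

theorem analyticAt_lieBracket {a b : Plane → Plane} {q : Plane} (ha : AnalyticAt ℂ a q)
    (hb : AnalyticAt ℂ b q) : AnalyticAt ℂ (lieBracket ℂ a b) q :=
  (analyticAt_fderiv_apply hb ha).sub (analyticAt_fderiv_apply ha hb)

/-- If `Y` preserves the foliations of `a` and `b`, i.e. if `[Y, a]` and `[Y, b]` are parallel to
`a` and `b`, then the web of `Y`, `a`, `b` has an adapted commuting frame: the multiple `X` of `a` for which `Y + X` is parallel to `b` commutes with `Y`, since `[Y, X]` and
`[Y, Y + X]` coincide, the former being parallel to `a` and the latter to `b`. -/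
theorem exists_isParallelFrame_of_bracket {V : Set Plane} (hV : IsOpen V) {Y a b : Plane → Plane}
    (hY : AnalyticOnNhd ℂ Y V) (ha : AnalyticOnNhd ℂ a V) (hb : AnalyticOnNhd ℂ b V)
    (hYa : ∀ q ∈ V, area (Y q) (a q) ≠ 0) (hYb : ∀ q ∈ V, area (Y q) (b q) ≠ 0)
    (hab : ∀ q ∈ V, area (a q) (b q) ≠ 0)
    (hsa : ∀ q ∈ V, area (lieBracket ℂ Y a q) (a q) = 0)
    (hsb : ∀ q ∈ V, area (lieBracket ℂ Y b q) (b q) = 0) :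
    ∃ X, IsParallelFrame V Y a b Y X := by
  set g : Plane → ℂ := fun q => -(area (Y q) (b q) / area (a q) (b q)) with hg
  set k : Plane → ℂ := fun q => area (a q) (Y q) / area (a q) (b q) with hk
  have hgan : AnalyticOnNhd ℂ g V := fun q hq =>
    ((analyticAt_area (hY q hq) (hb q hq)).div (analyticAt_area (ha q hq) (hb q hq))
      (hab q hq)).neg
  have hkan : AnalyticOnNhd ℂ k V := fun q hq =>
    (analyticAt_area (ha q hq) (hY q hq)).div (analyticAt_area (ha q hq) (hb q hq)) (hab q hq)
  have hsum : ∀ q ∈ V, Y q + g q • a q = k q • b q := by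
    intro q hq
    nth_rewrite 1 [eq_area_smul_add (Y q) (hab q hq)]
    simp only [hg, hk]
    module
  have hX : AnalyticOnNhd ℂ (fun q => g q • a q) V := hgan.smul ha
  refine ⟨fun q => g q • a q, ⟨hY, hX, ?_, ?_⟩, ?_, ?_, ?_⟩
  · intro q hq
    simp [hg, hYa q hq, hYb q hq, hab q hq]
  · intro q hq
    have hY' := (hY q hq).differentiableAt
    have ha' := (ha q hq).differentiableAt
    have hb' := (hb q hq).differentiableAt
    have hg' := (hgan q hq).differentiableAt
    have hk' := (hkan q hq).differentiableAt
    have e1 := lieBracket_smul_right (V := Y) hg' ha'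
    have e2 : lieBracket ℂ Y (fun q => g q • a q) q = lieBracket ℂ Y (fun q => k q • b q) q := by
      have h1 : (Y + fun q => g q • a q) =ᶠ[𝓝 q] fun q => k q • b q :=
        mem_of_superset (hV.mem_nhds hq) hsum
      rw [← (EventuallyEq.refl _ Y).lieBracket_vectorField_eq h1,
        lieBracket_add_right hY' (hX q hq).differentiableAt, lieBracket_self, Pi.zero_apply,
        zero_add]
    refine eq_zero_of_area_eq_zero (hab q hq) ?_ ?_
    · rw [area_eq_zero_comm, e1]
      simp [hsa q hq]
    · rw [e2, lieBracket_smul_right hk' hb']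
      simp [hsb q hq]
  · intro q _
    simp
  · intro q _
    simp
  · intro q hq
    rw [hsum q hq]
    simp

/-! ### Curvature and the propagation of flatness -/

/-- The connection form of the web of `n₁`, `n₂`, `n₁ + n₂`. It sends `x` to the determinant of
`[n₁, n₂]` and `x`, divided by that of `n₁` and `n₂`. -/
noncomputable def connectionForm (n₁ n₂ : Plane → Plane) (q : Plane) : Plane →L[ℂ] ℂ :=
  (area (n₁ q) (n₂ q))⁻¹ • area (lieBracket ℂ n₁ n₂ q)

theorem analyticAt_connectionForm {n₁ n₂ : Plane → Plane} {q : Plane} (h₁ : AnalyticAt ℂ n₁ q)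
    (h₂ : AnalyticAt ℂ n₂ q) (h : area (n₁ q) (n₂ q) ≠ 0) :
    AnalyticAt ℂ (connectionForm n₁ n₂) q :=
  ((analyticAt_area h₁ h₂).inv h).smul
    ((area.analyticAt _).comp (analyticAt_lieBracket h₁ h₂))

/-- The fields `f n₁` and `f n₂` commute exactly when the logarithmic derivative of `f` is the
connection form. -/
theorem lieBracket_smul_smul_eq_zero_iff {f : Plane → ℂ} {n₁ n₂ : Plane → Plane} {q : Plane}
    (hf : DifferentiableAt ℂ f q) (h₁ : DifferentiableAt ℂ n₁ q) (h₂ : DifferentiableAt ℂ n₂ q)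
    (hf0 : f q ≠ 0) (h : area (n₁ q) (n₂ q) ≠ 0) :
    lieBracket ℂ (fun p => f p • n₁ p) (fun p => f p • n₂ p) q = 0 ↔
      fderiv ℂ f q = f q • connectionForm n₁ n₂ q := by
  rw [lieBracket_smul_smul hf hf h₁ h₂]
  set B := lieBracket ℂ n₁ n₂ q with hB
  have hswap' : area (n₁ q) B = -area B (n₁ q) := area_swap _ _
  constructor
  · intro h0
    have e1 := congrArg (area (n₁ q)) h0
    have e2 := congrArg (fun z => area z (n₂ q)) h0
    simp only [map_add, map_sub, map_smul, map_zero, add_apply, sub_apply, smul_apply, zero_apply,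
      area_self, smul_eq_mul, mul_zero, sub_zero, zero_sub, hswap'] at e1 e2
    have k1 : fderiv ℂ f q (n₁ q) = f q * ((area (n₁ q) (n₂ q))⁻¹ * area B (n₁ q)) := by
      field_simp
      apply mul_left_cancel₀ hf0
      linear_combination e1
    have k2 : fderiv ℂ f q (n₂ q) = f q * ((area (n₁ q) (n₂ q))⁻¹ * area B (n₂ q)) := by
      field_simp
      apply mul_left_cancel₀ hf0
      linear_combination -e2
    refine ContinuousLinearMap.ext fun x => ?_
    rw [eq_area_smul_add x h]
    simp only [map_add, map_smul, k1, k2, smul_apply, smul_eq_mul, connectionForm, ← hB]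
  · intro h0
    rw [h0]
    refine eq_zero_of_area_eq_zero h ?_ ?_ <;>
    simp only [connectionForm, map_add, map_sub, map_smul, add_apply, sub_apply, smul_apply,
      area_self, smul_eq_mul, mul_zero, sub_zero, zero_sub, hswap', ← hB] <;> field_simp <;> ring

/-- If `df = f ω` with `f` nonvanishing, then `ω`, the logarithmic derivative of `f`, is closed. -/
theorem fderiv_symm_of_fderiv_eq_smul {E : Type*} [NormedAddCommGroup E] [NormedSpace ℂ E]
    {f : E → ℂ} {ω : E → E →L[ℂ] ℂ} {q : E} (hf : AnalyticAt ℂ f q)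
    (hω : AnalyticAt ℂ ω q) (hf0 : f q ≠ 0) (h : ∀ᶠ p in 𝓝 q, fderiv ℂ f p = f p • ω p)
    (x y : E) : fderiv ℂ ω q x y = fderiv ℂ ω q y x := by
  have h1 := (hf.differentiableAt.hasFDerivAt.fun_smul
    hω.differentiableAt.hasFDerivAt).congr_of_eventuallyEq h
  have hsymm := (hf.contDiffAt (n := ⊤)).isSymmSndFDerivAt le_top x y
  rw [h1.fderiv, h.self_of_nhds] at hsymm
  simp only [add_apply, smul_apply, ContinuousLinearMap.smulRight_apply, smul_eq_mul] at hsymm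
  apply mul_left_cancel₀ hf0
  linear_combination hsymm

/-- If a web on a connected domain admits an adapted commuting frame on some nonempty open subset,
then it is flat: its curvature, the exterior derivative of the connection form, is analytic and
vanishes on this subset, hence everywhere, so that the connection form has local primitives. -/
theorem isFlatWeb_of_isParallelFrame {Ω : Set Plane} (hΩ : IsOpen Ω) (hconn : IsPreconnected Ω)
    {a b c : Plane → Plane} (hweb : IsWeb Ω ![a, b, c]) {V : Set Plane} {u w : Plane → Plane}
    (hV : IsOpen V) (hne : V.Nonempty) (hVΩ : V ⊆ Ω) (h : IsParallelFrame V a b c u w) :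
    IsFlatWeb Ω ![a, b, c] := by
  obtain ⟨⟨ha, hb, hc⟩, hab, hbc, hac⟩ := isWeb_iff.1 hweb
  -- the multiples of `a` and `b` that add up to `c`
  set α : Plane → ℂ := fun q => area (c q) (b q) / area (a q) (b q) with hα
  set β : Plane → ℂ := fun q => area (a q) (c q) / area (a q) (b q) with hβ
  have hα0 : ∀ q ∈ Ω, α q ≠ 0 := fun q hq =>
    div_ne_zero (mt area_eq_zero_comm.1 (hbc q hq)) (hab q hq)
  have hβ0 : ∀ q ∈ Ω, β q ≠ 0 := fun q hq => div_ne_zero (hac q hq) (hab q hq)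
  set n₁ : Plane → Plane := fun q => α q • a q with hn₁
  set n₂ : Plane → Plane := fun q => β q • b q with hn₂
  have h₁ : AnalyticOnNhd ℂ n₁ Ω := fun q hq => ((analyticAt_area (hc q hq) (hb q hq)).div
    (analyticAt_area (ha q hq) (hb q hq)) (hab q hq)).smul (ha q hq)
  have h₂ : AnalyticOnNhd ℂ n₂ Ω := fun q hq => ((analyticAt_area (ha q hq) (hc q hq)).div
    (analyticAt_area (ha q hq) (hb q hq)) (hab q hq)).smul (hb q hq)
  have hsum : ∀ q ∈ Ω, n₁ q + n₂ q = c q := fun q hq => (eq_area_smul_add (c q) (hab q hq)).symm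
  have hD : ∀ q ∈ Ω, area (n₁ q) (n₂ q) ≠ 0 := by
    intro q hq
    simp [hn₁, hn₂, hα0 q hq, hβ0 q hq, hab q hq]
  have hω : AnalyticOnNhd ℂ (connectionForm n₁ n₂) Ω := fun q hq =>
    analyticAt_connectionForm (h₁ q hq) (h₂ q hq) (hD q hq)
  -- the adapted frame on `V` is `f n₁`, `f n₂` with `f` nowhere zero
  set f : Plane → ℂ := fun q => area (a q) (u q + w q) / area (a q) (c q) with hf
  have hfan : AnalyticOnNhd ℂ f V := fun q hq =>
    (analyticAt_area (ha q (hVΩ hq)) ((h.left q hq).add (h.right q hq))).div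
      (analyticAt_area (ha q (hVΩ hq)) (hc q (hVΩ hq))) (hac q (hVΩ hq))
  have hfuw : ∀ q ∈ V, u q + w q = f q • c q := fun q hq =>
    eq_area_smul (hac q (hVΩ hq)) (h.area_add q hq)
  have hf0 : ∀ q ∈ V, f q ≠ 0 := by
    intro q hq h0
    have h1 := hfuw q hq
    rw [h0, zero_smul] at h1
    have h2 : area (u q) (u q + w q) = 0 := by rw [h1, map_zero]
    exact h.transverse q hq (by simpa using h2)
  have hu : ∀ q ∈ V, u q = f q • n₁ q := by
    intro q hq
    rw [← sub_eq_zero]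
    have h1 : area (u q - f q • n₁ q) (a q) = 0 := by
      simp [hn₁, h.area_left q hq]
    refine eq_zero_of_area_eq_zero (hab q (hVΩ hq)) (area_eq_zero_comm.1 h1) ?_
    have h2 : u q - f q • n₁ q = f q • n₂ q - w q := by
      have := hfuw q hq
      rw [← hsum q (hVΩ hq), smul_add] at this
      rw [sub_eq_sub_iff_add_eq_add, this, add_comm]
    rw [h2]
    simp [hn₂, h.area_right q hq]
  have hw : ∀ q ∈ V, w q = f q • n₂ q := by
    intro q hq
    have := hfuw q hq
    rw [← hsum q (hVΩ hq), smul_add, ← hu q hq] at this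
    exact add_left_cancel this
  have hdf : ∀ q ∈ V, fderiv ℂ f q = f q • connectionForm n₁ n₂ q := by
    intro q hq
    rw [← lieBracket_smul_smul_eq_zero_iff (hfan q hq).differentiableAt
      (h₁ q (hVΩ hq)).differentiableAt (h₂ q (hVΩ hq)).differentiableAt (hf0 q hq)
      (hD q (hVΩ hq)), ← h.bracket q hq]
    have e1 : u =ᶠ[𝓝 q] fun q => f q • n₁ q := mem_of_superset (hV.mem_nhds hq) hu
    have e2 : w =ᶠ[𝓝 q] fun q => f q • n₂ q := mem_of_superset (hV.mem_nhds hq) hw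
    exact (e1.lieBracket_vectorField_eq e2).symm
  -- the curvature
  set K : Plane → ℂ := fun q => fderiv ℂ (connectionForm n₁ n₂) q (1, 0) (0, 1) -
    fderiv ℂ (connectionForm n₁ n₂) q (0, 1) (1, 0) with hK
  have hKan : AnalyticOnNhd ℂ K Ω := by
    have : ∀ x y : Plane, AnalyticOnNhd ℂ
        (fun q => fderiv ℂ (connectionForm n₁ n₂) q x y) Ω := fun x y q hq =>
      ((ContinuousLinearMap.apply ℂ ℂ y).analyticAt _).comp
        (analyticAt_fderiv_apply (hω q hq) (analyticAt_const (v := x)))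
    exact (this _ _).sub (this _ _)
  have hKV : ∀ q ∈ V, K q = 0 := fun q hq => sub_eq_zero.2
    (fderiv_symm_of_fderiv_eq_smul (hfan q hq) (hω q (hVΩ hq)) (hf0 q hq)
      (mem_of_superset (hV.mem_nhds hq) hdf) _ _)
  obtain ⟨z, hz⟩ := hne
  have hK0 : EqOn K 0 Ω := hKan.eqOn_zero_of_preconnected_of_eventuallyEq_zero hconn (hVΩ hz)
    (mem_of_superset (hV.mem_nhds hz) hKV)
  refine (isFlatWeb_iff hweb).2 fun p hp => ?_
  obtain ⟨W, g, hW, hpW, hWΩ, hg, hgω⟩ := exists_analytic_primitive hΩ hω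
    (fun q hq => bilin_symm_of_basis _ (a := (1, 0)) (b := (0, 1)) (by simp [area_apply])
      (sub_eq_zero.1 (hK0 hq))) hp
  have hE : AnalyticOnNhd ℂ (fun q => Complex.exp (g q)) W := fun q hq => (hg q hq).cexp
  refine ⟨W, fun q => Complex.exp (g q) • n₁ q, fun q => Complex.exp (g q) • n₂ q, hW, hpW, hWΩ,
    ⟨hE.smul (h₁.mono hWΩ), hE.smul (h₂.mono hWΩ), ?_, ?_⟩, ?_, ?_, ?_⟩
  · intro q hq
    simp [Complex.exp_ne_zero, hD q (hWΩ hq)]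
  · intro q hq
    rw [lieBracket_smul_smul_eq_zero_iff (hE q hq).differentiableAt
      (h₁ q (hWΩ hq)).differentiableAt (h₂ q (hWΩ hq)).differentiableAt (Complex.exp_ne_zero _)
      (hD q (hWΩ hq))]
    exact (hgω q hq).cexp.fderiv
  · intro q _
    simp [hn₁]
  · intro q _
    simp [hn₂]
  · intro q hq
    rw [← smul_add, hsum q (hWΩ hq)]
    simp

/-! ### Symmetries and their flows -/

/-- If the local flow of `Y` preserves the foliation of `v`, then `[Y, v]` is parallel to `v`. -/
theorem area_lieBracket_eq_zero_of_flow {Ω U : Set Plane} {Y v : Plane → Plane} {ε : ℝ}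
    {Φ : ℂ → Plane → Plane} (hΦ : IsLocalFlow Ω Y U ε Φ) (hv : AnalyticOnNhd ℂ v Ω)
    (hpres : ∀ t ∈ Metric.ball (0 : ℂ) ε, ∀ q ∈ U, area (fderiv ℂ (Φ t) q (v q)) (v (Φ t q)) = 0)
    {q : Plane} (hq : q ∈ U) : area (lieBracket ℂ Y v q) (v q) = 0 := by
  have h0 : (0 : ℂ) ∈ Metric.ball (0 : ℂ) ε := Metric.mem_ball_self hΦ.pos
  set Ψ : ℂ × Plane → Plane := fun z => Φ z.1 z.2 with hΨ
  have hΨan : ∀ t ∈ Metric.ball (0 : ℂ) ε, ∀ x ∈ U, AnalyticAt ℂ Ψ (t, x) :=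
    fun t ht x hx => hΦ.holomorphic _ ⟨ht, hx⟩
  -- the partial derivatives of the flow
  have hspace : ∀ t ∈ Metric.ball (0 : ℂ) ε, ∀ x ∈ U, ∀ z,
      fderiv ℂ (Φ t) x z = fderiv ℂ Ψ (t, x) (0, z) := by
    intro t ht x hx z
    have h1 := (hΨan t ht x hx).differentiableAt.hasFDerivAt.comp x
      (hasFDerivAt_prodMk_right (𝕜 := ℂ) t x)
    have h2 : Ψ ∘ (fun y => (t, y)) = Φ t := rfl
    rw [h2] at h1
    rw [h1.fderiv]
    rfl
  have htime : ∀ x ∈ U, fderiv ℂ Ψ (0, x) (1, 0) = Y x := by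
    intro x hx
    have h1 := (hΨan 0 h0 x hx).differentiableAt.hasFDerivAt.comp (0 : ℂ)
      (hasFDerivAt_prodMk_left (𝕜 := ℂ) (0 : ℂ) x)
    have h2 := h1.hasDerivAt.unique (hΦ.ode 0 h0 x hx)
    rw [hΦ.initial x hx] at h2
    rw [← h2]
    rfl
  have hD := (hΨan 0 h0 q hq).fderiv.differentiableAt.hasFDerivAt
  -- the mixed second derivative of the flow is the derivative of `Y`
  have hmixed : fderiv ℂ Y q (v q) = fderiv ℂ (fderiv ℂ Ψ) (0, q) (0, v q) (1, 0) := by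
    have h1 := (hD.comp q (hasFDerivAt_prodMk_right (𝕜 := ℂ) (0 : ℂ) q)).clm_apply
      (hasFDerivAt_const ((1, 0) : ℂ × Plane) q)
    have h2 : Y =ᶠ[𝓝 q] fun x => (fderiv ℂ Ψ ∘ fun y => (0, y)) x (1, 0) :=
      mem_of_superset (hΦ.isOpen.mem_nhds hq) fun x hx => (htime x hx).symm
    rw [(h1.congr_of_eventuallyEq h2).fderiv]
    simp
  have hsymm := ((hΨan 0 h0 q hq).contDiffAt (n := ⊤)).isSymmSndFDerivAt le_top
    (0, v q) (1, 0)
  have hqΩ := hΦ.subset hq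
  have hA : HasDerivAt (fun t => fderiv ℂ (Φ t) q (v q)) (fderiv ℂ Y q (v q)) 0 := by
    have h1 := ((hD.comp (0 : ℂ) (hasFDerivAt_prodMk_left (𝕜 := ℂ) (0 : ℂ) q)).clm_apply
      (hasFDerivAt_const ((0, v q) : ℂ × Plane) (0 : ℂ))).hasDerivAt
    have h2 : (fun t => fderiv ℂ (Φ t) q (v q)) =ᶠ[𝓝 0]
        fun t => (fderiv ℂ Ψ ∘ fun y => (y, q)) t (0, v q) :=
      mem_of_superset (Metric.isOpen_ball.mem_nhds h0) fun t ht => hspace t ht q hq _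
    refine (h1.congr_of_eventuallyEq h2).congr_deriv ?_
    rw [hmixed, hsymm]
    simp
  have hC : HasDerivAt (fun t => v (Φ t q)) (fderiv ℂ v q (Y q)) 0 := by
    have h1 := hΦ.ode 0 h0 q hq
    have h2 := (hv q hqΩ).differentiableAt.hasFDerivAt
    rw [← hΦ.initial q hq] at h2
    have h3 := h2.comp_hasDerivAt (0 : ℂ) h1
    rw [hΦ.initial q hq] at h3
    exact h3
  have hbil := (area.hasFDerivAt.comp_hasDerivAt (0 : ℂ) hA).clm_apply hC
  have hzero : (fun t => area (fderiv ℂ (Φ t) q (v q)) (v (Φ t q))) =ᶠ[𝓝 0] fun _ => 0 :=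
    mem_of_superset (Metric.isOpen_ball.mem_nhds h0) fun t ht => hpres t ht q hq
  have hres := hbil.unique ((hasDerivAt_const (0 : ℂ) (0 : ℂ)).congr_of_eventuallyEq hzero)
  have hid : fderiv ℂ (Φ 0) q (v q) = v q := by
    have h1 : Φ 0 =ᶠ[𝓝 q] id := mem_of_superset (hΦ.isOpen.mem_nhds hq) hΦ.initial
    rw [h1.fderiv_eq]
    simp
  simp only [Function.comp_apply, hid, hΦ.initial q hq] at hres
  rw [lieBracket, map_sub, sub_apply]
  rw [area_swap (v q)] at hres
  linear_combination -hres

theorem area_lieBracket_eq_zero_of_symmetry {Ω : Set Plane} {v : Fin 3 → Plane → Plane}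
    {Y : Plane → Plane} (hv : ∀ i, AnalyticOnNhd ℂ (v i) Ω)
    (hY : IsInfinitesimalSymmetry Ω v Y) (i : Fin 3) {q : Plane} (hq : q ∈ Ω) :
    area (lieBracket ℂ Y (v i) q) (v i q) = 0 := by
  obtain ⟨U, ε, Φ, hqU, hΦ, hpres⟩ := hY q hq
  exact area_lieBracket_eq_zero_of_flow hΦ (hv i)
    (fun t ht x hx => area_eq_zero_of_mem_span (hpres t ht x hx i)) hqU

/-- In rectifying coordinates of a commuting frame `u`, `w` the flow of `u + w` consists of
translations. It therefore preserves `u` and `w`, and also `u + s w` if `s` is constant along the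
flow. -/
theorem isInfinitesimalSymmetry_of_frame {V : Set Plane} (hV : IsOpen V)
    {u w a b c Y : Plane → Plane} {s : Plane → ℂ} (h : IsCommutingFrame V u w)
    (hs : AnalyticOnNhd ℂ s V) (hds : ∀ q ∈ V, fderiv ℂ s q (u q + w q) = 0)
    (hY : ∀ q ∈ V, Y q = u q + w q) (ha0 : ∀ q ∈ V, a q ≠ 0) (hb0 : ∀ q ∈ V, b q ≠ 0)
    (hc0 : ∀ q ∈ V, c q ≠ 0) (ha : ∀ q ∈ V, area (u q) (a q) = 0)
    (hb : ∀ q ∈ V, area (w q) (b q) = 0) (hc : ∀ q ∈ V, area (u q + s q • w q) (c q) = 0) :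
    IsInfinitesimalSymmetry V ![a, b, c] Y := by
  intro p hp
  obtain ⟨φ, hpφ, hφV, hφ, hφs, hφuw⟩ := h.exists_rectifying hV hp
  obtain ⟨r, hr, hball⟩ := Metric.isOpen_iff.1 φ.open_target (φ p) (φ.map_source hpφ)
  set U : Set Plane := φ.source ∩ φ ⁻¹' Metric.ball (φ p) (r / 2) with hU
  have hUo : IsOpen U := φ.isOpen_inter_preimage Metric.isOpen_ball
  have htarget : ∀ t ∈ Metric.ball (0 : ℂ) (r / 2), ∀ q ∈ U,
      φ q + t • ((1, 1) : Plane) ∈ φ.target := by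
    intro t ht q hq
    apply hball
    have h1 : dist (φ q) (φ p) < r / 2 := hq.2
    have h2 : ‖t • ((1, 1) : Plane)‖ < r / 2 := by
      rw [norm_smul]
      simpa [Prod.norm_def] using ht
    rw [Metric.mem_ball]
    calc dist (φ q + t • ((1, 1) : Plane)) (φ p)
        ≤ dist (φ q + t • ((1, 1) : Plane)) (φ q) + dist (φ q) (φ p) := dist_triangle _ _ _
      _ < r := by rw [dist_self_add_left]; linarith
  -- the inverse of the coordinate system takes coordinate vectors back to the frame
  have hsymm : ∀ z ∈ φ.target, fderiv ℂ φ.symm z (1, 0) = u (φ.symm z) ∧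
      fderiv ℂ φ.symm z (0, 1) = w (φ.symm z) := by
    intro z hz
    have hq := φ.map_target hz
    have h1 := fderiv_symm_comp_fderiv φ hφ hφs hq
    rw [φ.right_inv hz] at h1
    constructor
    · rw [← (hφuw _ hq).1]
      exact congrArg (fun L : Plane →L[ℂ] Plane => L (u (φ.symm z))) h1
    · rw [← (hφuw _ hq).2]
      exact congrArg (fun L : Plane →L[ℂ] Plane => L (w (φ.symm z))) h1
  set Φ : ℂ → Plane → Plane := fun t q => φ.symm (φ q + t • ((1, 1) : Plane)) with hΦ
  have hΦV : ∀ t ∈ Metric.ball (0 : ℂ) (r / 2), ∀ q ∈ U, Φ t q ∈ V := fun t ht q hq =>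
    hφV (φ.map_target (htarget t ht q hq))
  have hinit : ∀ q ∈ U, Φ 0 q = q := by
    intro q hq
    change φ.symm (φ q + (0 : ℂ) • ((1, 1) : Plane)) = q
    rw [zero_smul, add_zero, φ.left_inv hq.1]
  have hode : ∀ t ∈ Metric.ball (0 : ℂ) (r / 2), ∀ q ∈ U,
      HasDerivAt (fun s => Φ s q) (u (Φ t q) + w (Φ t q)) t := by
    intro t ht q hq
    have hz := htarget t ht q hq
    have h1 : HasDerivAt (fun s : ℂ => φ q + s • ((1, 1) : Plane)) (1, 1) t := by
      simpa using ((hasDerivAt_id t).smul_const ((1, 1) : Plane)).const_add (φ q)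
    have h2 := (hφs _ hz).differentiableAt.hasFDerivAt.comp_hasDerivAt t h1
    have h3 : ((1, 1) : Plane) = (1, 0) + (0, 1) := by simp
    rw [h3, map_add, (hsymm _ (by rw [← h3]; exact hz)).1,
      (hsymm _ (by rw [← h3]; exact hz)).2, ← h3] at h2
    exact h2
  have hflow : IsLocalFlow V Y U (r / 2) Φ := by
    refine ⟨hUo, fun q hq => hφV hq.1, half_pos hr, ?_, hΦV, ?_, ?_⟩
    · rintro ⟨t, q⟩ ⟨ht, hq⟩
      have h1 : AnalyticAt ℂ (fun z : ℂ × Plane => φ z.2 + z.1 • ((1, 1) : Plane)) (t, q) :=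
        ((hφ q hq.1).fun_comp_of_eq analyticAt_snd rfl).add (analyticAt_fst.smul analyticAt_const)
      exact (hφs _ (htarget t ht q hq)).fun_comp_of_eq h1 rfl
    · exact hinit
    · intro t ht q hq
      rw [hY _ (hΦV t ht q hq)]
      exact hode t ht q hq
  have hframe : ∀ t ∈ Metric.ball (0 : ℂ) (r / 2), ∀ q ∈ U,
      fderiv ℂ (Φ t) q (u q) = u (Φ t q) ∧ fderiv ℂ (Φ t) q (w q) = w (Φ t q) := by
    intro t ht q hq
    have hz := htarget t ht q hq
    have h1 := (hφs _ hz).differentiableAt.hasFDerivAt.comp q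
      ((hφ q hq.1).differentiableAt.hasFDerivAt.add_const (t • ((1, 1) : Plane)))
    have h2 : HasFDerivAt (Φ t) _ q := h1
    rw [h2.fderiv]
    simp only [ContinuousLinearMap.comp_apply, (hφuw q hq.1).1, (hφuw q hq.1).2]
    exact hsymm _ hz
  have hsconst : ∀ t ∈ Metric.ball (0 : ℂ) (r / 2), ∀ q ∈ U, s (Φ t q) = s q := by
    intro t ht q hq
    have h1 : ∀ t ∈ Metric.ball (0 : ℂ) (r / 2), HasDerivAt (fun t => s (Φ t q)) 0 t := by
      intro t ht
      have h2 := (hs _ (hΦV t ht q hq)).differentiableAt.hasFDerivAt.comp_hasDerivAt t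
        (hode t ht q hq)
      rw [hds _ (hΦV t ht q hq)] at h2
      exact h2
    have h3 := Metric.isOpen_ball.is_const_of_deriv_eq_zero
      (convex_ball (0 : ℂ) (r / 2)).isPreconnected
      (fun t ht => (h1 t ht).differentiableAt.differentiableWithinAt)
      (fun t ht => (h1 t ht).deriv) ht (Metric.mem_ball_self (half_pos hr))
    rw [h3, hinit q hq]
  refine ⟨U, r / 2, Φ, ⟨hpφ, Metric.mem_ball_self (half_pos hr)⟩, hflow, fun t ht q hq i => ?_⟩
  have hqV : q ∈ V := hφV hq.1
  have hΦq := hΦV t ht q hq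
  have htr := h.transverse q hqV
  have htr' := h.transverse _ hΦq
  -- a field parallel to one with invariant coefficients in the frame is preserved
  have key : ∀ (z m : Plane → Plane), z (Φ t q) ≠ 0 → m q ≠ 0 → m (Φ t q) ≠ 0 →
      area (m q) (z q) = 0 → area (m (Φ t q)) (z (Φ t q)) = 0 →
      fderiv ℂ (Φ t) q (m q) = m (Φ t q) →
      fderiv ℂ (Φ t) q (z q) ∈ Submodule.span ℂ {z (Φ t q)} := by
    intro z m hz hm hm' h1 h2 h3
    obtain ⟨k, hk⟩ := Submodule.mem_span_singleton.1
      ((mem_span_singleton_iff_area hm).2 (area_eq_zero_comm.1 h1))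
    rw [← hk, map_smul, h3, mem_span_singleton_iff_area hz, map_smul, smul_apply, h2, smul_zero]
  have hsum0 : ∀ x ∈ V, u x + s x • w x ≠ 0 := by
    intro x hx h0
    have h1 : area (u x + s x • w x) (w x) = 0 := by rw [h0]; simp
    exact h.transverse x hx (by simpa using h1)
  fin_cases i
  · exact key a u (ha0 _ hΦq) (left_ne_zero_of_area htr) (left_ne_zero_of_area htr')
      (ha q hqV) (ha _ hΦq) (hframe t ht q hq).1
  · exact key b w (hb0 _ hΦq) (right_ne_zero_of_area htr) (right_ne_zero_of_area htr')
      (hb q hqV) (hb _ hΦq) (hframe t ht q hq).2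
  · refine key c (fun x => u x + s x • w x) (hc0 _ hΦq) (hsum0 q hqV) (hsum0 _ hΦq)
      (hc q hqV) (hc _ hΦq) ?_
    simp only [map_add, map_smul, (hframe t ht q hq).1, (hframe t ht q hq).2,
      hsconst t ht q hq]

/-! ### Webs generated by a symmetry -/

/-- Along a symmetry `Z` of a web (expressed by brackets) in the direction of `Y`, each of the three webs obtained by
replacing one of the foliations by that of `Y` has an adapted commuting frame. -/
theorem exists_isParallelFrame_of_bracket_web {V : Set Plane} (hV : IsOpen V)
    {a b c Y Z : Plane → Plane} (hweb : IsWeb V ![a, b, c]) (hZ : AnalyticOnNhd ℂ Z V)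
    (hZa : ∀ q ∈ V, area (Z q) (a q) ≠ 0) (hZb : ∀ q ∈ V, area (Z q) (b q) ≠ 0)
    (hZc : ∀ q ∈ V, area (Z q) (c q) ≠ 0)
    (hbr : ∀ i, ∀ q ∈ V, area (lieBracket ℂ Z (![a, b, c] i) q) (![a, b, c] i q) = 0)
    (hZY : ∀ q ∈ V, area (Z q) (Y q) = 0) :
    (∃ u w, IsParallelFrame V Y b c u w) ∧ (∃ u w, IsParallelFrame V a Y c u w) ∧
      ∃ u w, IsParallelFrame V a b Y u w := by
  obtain ⟨⟨ha, hb, hc⟩, hab, hbc, hac⟩ := isWeb_iff.1 hweb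
  have hZ0 : ∀ q ∈ V, Z q ≠ 0 := fun q hq => left_ne_zero_of_area (hZa q hq)
  obtain ⟨X₁, h₁⟩ := exists_isParallelFrame_of_bracket hV hZ hb hc hZb hZc hbc (hbr 1) (hbr 2)
  obtain ⟨X₂, h₂⟩ := exists_isParallelFrame_of_bracket hV hZ ha hc hZa hZc hac (hbr 0) (hbr 2)
  obtain ⟨X₃, h₃⟩ := exists_isParallelFrame_of_bracket hV hZ ha hb hZa hZb hab (hbr 0) (hbr 1)
  exact ⟨⟨_, _, h₁.congr_left hZ0 hZY⟩, ⟨_, _, (h₂.congr_left hZ0 hZY).swap⟩,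
    ⟨_, _, (h₃.congr_left hZ0 hZY).swap.rotate⟩⟩

/-- A nonzero field that preserves the foliations of `b` and `c` cannot be tangent to that of `a`
on an open set, unless the web of `a`, `b`, `c` is flat somewhere. -/
theorem exists_area_ne_zero_of_bracket {Ω : Set Plane} (hconn : IsPreconnected Ω)
    {a b c Y : Plane → Plane} (hY : AnalyticOnNhd ℂ Y Ω) (hY0 : ∃ p ∈ Ω, Y p ≠ 0)
    (hb : AnalyticOnNhd ℂ b Ω) (hc : AnalyticOnNhd ℂ c Ω)
    (hab : ∀ q ∈ Ω, area (a q) (b q) ≠ 0) (hac : ∀ q ∈ Ω, area (a q) (c q) ≠ 0)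
    (hbc : ∀ q ∈ Ω, area (b q) (c q) ≠ 0)
    (hsb : ∀ q ∈ Ω, area (lieBracket ℂ Y b q) (b q) = 0)
    (hsc : ∀ q ∈ Ω, area (lieBracket ℂ Y c q) (c q) = 0)
    (hno : ∀ V u w, IsOpen V → V.Nonempty → V ⊆ Ω → ¬ IsParallelFrame V a b c u w)
    {V : Set Plane} (hV : IsOpen V) (hne : V.Nonempty) (hVΩ : V ⊆ Ω) :
    ∃ q ∈ V, area (Y q) (a q) ≠ 0 := by
  by_contra! hzero
  obtain ⟨z, hzV, hz⟩ : ∃ q ∈ V, Y q ≠ 0 := by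
    by_contra! h0
    obtain ⟨x, hx⟩ := hne
    obtain ⟨p, hp, hYp⟩ := hY0
    exact hYp (hY.eqOn_zero_of_preconnected_of_eventuallyEq_zero hconn (hVΩ hx)
      (mem_of_superset (hV.mem_nhds hx) h0) hp)
  set W : Set Plane := V ∩ Y ⁻¹' {0}ᶜ with hW
  have hWo : IsOpen W := (hY.continuousOn.mono hVΩ).isOpen_inter_preimage hV isOpen_compl_singleton
  have hWΩ : W ⊆ Ω := inter_subset_left.trans hVΩ
  have htrans : ∀ d : Plane → Plane, (∀ q ∈ Ω, area (a q) (d q) ≠ 0) →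
      ∀ q ∈ W, area (Y q) (d q) ≠ 0 := fun d hd q hq h0 =>
    hd q (hWΩ hq) (area_eq_zero_trans hq.2 (area_eq_zero_comm.1 (hzero q hq.1)) h0)
  obtain ⟨X, hX⟩ := exists_isParallelFrame_of_bracket hWo (hY.mono hWΩ) (hb.mono hWΩ)
    (hc.mono hWΩ) (htrans b hab) (htrans c hac) (fun q hq => hbc q (hWΩ hq))
    (fun q hq => hsb q (hWΩ hq)) (fun q hq => hsc q (hWΩ hq))
  exact hno W _ _ hWo ⟨z, hzV, hz⟩ hWΩ
    (hX.congr_left (fun q hq => hq.2) (fun q hq => hzero q hq.1))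

theorem isOpen_transversalityLocus {Ω : Set Plane} (hΩ : IsOpen Ω) {v : Fin 3 → Plane → Plane}
    {Y : Plane → Plane} (hv : ∀ i, AnalyticOnNhd ℂ (v i) Ω) (hY : AnalyticOnNhd ℂ Y Ω) :
    IsOpen (transversalityLocus Ω v Y) := by
  have h : transversalityLocus Ω v Y =
      ⋂ i, (Ω ∩ (fun q => area (Y q) (v i q)) ⁻¹' {0}ᶜ) := by
    ext q
    simp only [transversalityLocus, linearIndependent_pair_iff_area, mem_ofPred_eq, mem_iInter,
      mem_inter_iff, mem_preimage, mem_compl_iff, mem_singleton_iff]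
    exact ⟨fun h i => ⟨h.1, h.2 i⟩, fun h => ⟨(h 0).1, fun i => (h i).2⟩⟩
  rw [h]
  refine isOpen_iInter_of_finite fun i => ?_
  have hc : ContinuousOn (fun q => area (Y q) (v i q)) Ω := fun q hq =>
    (analyticAt_area (hY q hq) (hv i q hq)).continuousAt.continuousWithinAt
  exact hc.isOpen_inter_preimage hΩ isOpen_compl_singleton

theorem IsWeb.mono {Ω V : Set Plane} {v : Fin 3 → Plane → Plane} (h : IsWeb Ω v) (hV : V ⊆ Ω) :
    IsWeb V v :=
  ⟨fun i => (h.holomorphic i).mono hV, fun i j hij p hp => h.transverse i j hij p (hV hp)⟩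

/-! ### Symmetries from three flat webs -/

/-- Commuting frames with the same directions differ by factors each of which is constant along
the other direction. -/
theorem IsCommutingFrame.exists_factors {V : Set Plane} (hV : IsOpen V)
    {u w x y : Plane → Plane} (h : IsCommutingFrame V u w) (h' : IsCommutingFrame V x y)
    (hxu : ∀ q ∈ V, area (x q) (u q) = 0) (hyw : ∀ q ∈ V, area (y q) (w q) = 0) :
    ∃ A B : Plane → ℂ, AnalyticOnNhd ℂ A V ∧ AnalyticOnNhd ℂ B V ∧
      (∀ q ∈ V, A q ≠ 0) ∧ (∀ q ∈ V, B q ≠ 0) ∧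
      (∀ q ∈ V, x q = A q • u q) ∧ (∀ q ∈ V, y q = B q • w q) ∧
      (∀ q ∈ V, fderiv ℂ A q (w q) = 0) ∧ ∀ q ∈ V, fderiv ℂ B q (u q) = 0 := by
  set A : Plane → ℂ := fun q => area (w q) (x q) / area (w q) (u q) with hA
  set B : Plane → ℂ := fun q => area (u q) (y q) / area (u q) (w q) with hB
  have ht : ∀ q ∈ V, area (w q) (u q) ≠ 0 := fun q hq =>
    mt area_eq_zero_comm.1 (h.transverse q hq)
  have hAan : AnalyticOnNhd ℂ A V := fun q hq =>
    (analyticAt_area (h.right q hq) (h'.left q hq)).div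
      (analyticAt_area (h.right q hq) (h.left q hq)) (ht q hq)
  have hBan : AnalyticOnNhd ℂ B V := fun q hq =>
    (analyticAt_area (h.left q hq) (h'.right q hq)).div
      (analyticAt_area (h.left q hq) (h.right q hq)) (h.transverse q hq)
  have hx : ∀ q ∈ V, x q = A q • u q := fun q hq => eq_area_smul (ht q hq) (hxu q hq)
  have hy : ∀ q ∈ V, y q = B q • w q := fun q hq =>
    eq_area_smul (h.transverse q hq) (hyw q hq)
  have hA0 : ∀ q ∈ V, A q ≠ 0 := by
    intro q hq h0
    apply left_ne_zero_of_area (h'.transverse q hq)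
    rw [hx q hq, h0, zero_smul]
  have hB0 : ∀ q ∈ V, B q ≠ 0 := by
    intro q hq h0
    apply right_ne_zero_of_area (h'.transverse q hq)
    rw [hy q hq, h0, zero_smul]
  have hbr : ∀ q ∈ V, (A q * fderiv ℂ B q (u q)) • w q - (B q * fderiv ℂ A q (w q)) • u q = 0 := by
    intro q hq
    have e1 : x =ᶠ[𝓝 q] fun p => A p • u p := mem_of_superset (hV.mem_nhds hq) hx
    have e2 : y =ᶠ[𝓝 q] fun p => B p • w p := mem_of_superset (hV.mem_nhds hq) hy
    have e3 := h'.bracket q hq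
    rw [e1.lieBracket_vectorField_eq e2, lieBracket_smul_smul (hAan q hq).differentiableAt
      (hBan q hq).differentiableAt (h.left q hq).differentiableAt (h.right q hq).differentiableAt,
      h.bracket q hq, smul_zero, add_zero] at e3
    exact e3
  refine ⟨A, B, hAan, hBan, hA0, hB0, hx, hy, fun q hq => ?_, fun q hq => ?_⟩
  · have := congrArg (area (w q)) (hbr q hq)
    simpa [ht q hq, hB0 q hq] using this
  · have := congrArg (area (u q)) (hbr q hq)
    simpa [h.transverse q hq, hA0 q hq] using this

/-- If `a` and `b` commute and `f` is constant along `a`, then so is the derivative of `f`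
along `b`. -/
theorem fderiv_fderiv_eq_zero_of_bracket {V : Set Plane} (hV : IsOpen V) {a b : Plane → Plane}
    {f : Plane → ℂ} {q : Plane} (hq : q ∈ V) (hf : AnalyticAt ℂ f q) (ha : AnalyticAt ℂ a q)
    (hb : AnalyticAt ℂ b q) (hab : lieBracket ℂ a b q = 0)
    (h : ∀ p ∈ V, fderiv ℂ f p (a p) = 0) :
    fderiv ℂ (fun p => fderiv ℂ f p (b p)) q (a q) = 0 := by
  have h1 := fderiv_apply_lieBracket (𝕜 := ℂ) (n := ⊤) hf.contDiffAt le_top hb.differentiableAt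
    ha.differentiableAt
  have h2 : (fun p => fderiv ℂ f p (a p)) =ᶠ[𝓝 q] fun _ => 0 :=
    mem_of_superset (hV.mem_nhds hq) h
  rw [hab, h2.fderiv_eq] at h1
  simpa using h1.symm

theorem fderiv_div_apply_eq_zero {f g : Plane → ℂ} {q x : Plane} (hf : DifferentiableAt ℂ f q)
    (hg : DifferentiableAt ℂ g q) (hg0 : g q ≠ 0) (hfx : fderiv ℂ f q x = 0)
    (hgx : fderiv ℂ g q x = 0) : fderiv ℂ (fun p => f p / g p) q x = 0 := by
  simp only [div_eq_mul_inv]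
  rw [fderiv_fun_mul hf (hg.fun_inv hg0)]
  have h := ((hasDerivAt_inv hg0).comp_hasFDerivAt q hg.hasFDerivAt).fderiv
  have h' : fderiv ℂ (fun p => (g p)⁻¹) q x = 0 := by
    change fderiv ℂ (Inv.inv ∘ g) q x = 0
    rw [h]
    simp [hgx]
  simp [hfx, h']

/-- Let `u`, `w`, `u + w` be adapted to the flat web of `a`, `b`, `Y`, and let `c` be parallel to
`u + s w`. If the webs of `Y`, `b`, `c` and of `a`, `Y`, `c` are flat as well, while that of `a`,
`b`, `c` is flat on no open subset, then `s` is constant along `u + w`. Otherwise, with `D` the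
derivative along `u + w`, the multiples of `u` and `w` by `(1 - s) / D s` and `s (1 - s) / D s`
would be an adapted commuting frame for the web of `a`, `b`, `c`. -/
theorem fderiv_slope_eq_zero {V : Set Plane} (hV : IsOpen V)
    {a b c Y u w x y z t : Plane → Plane} {s : Plane → ℂ}
    (h₃ : IsParallelFrame V a b Y u w) (h₂ : IsParallelFrame V a Y c x y)
    (h₁ : IsParallelFrame V Y b c z t) (hs : AnalyticOnNhd ℂ s V)
    (hc : ∀ q ∈ V, area (u q + s q • w q) (c q) = 0)
    (ha0 : ∀ q ∈ V, a q ≠ 0) (hb0 : ∀ q ∈ V, b q ≠ 0) (hc0 : ∀ q ∈ V, c q ≠ 0)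
    (hY0 : ∀ q ∈ V, Y q ≠ 0)
    (hno : ∀ W f g, IsOpen W → W.Nonempty → W ⊆ V → ¬ IsParallelFrame W a b c f g) :
    ∀ q ∈ V, fderiv ℂ s q (u q + w q) = 0 := by
  set D : Plane → Plane := u + w with hD
  have hu := h₃.left
  have hw := h₃.right
  have hDan : AnalyticOnNhd ℂ D V := hu.add hw
  have huD : IsCommutingFrame V u D := by
    refine ⟨hu, hDan, fun q hq => by simpa [hD] using h₃.transverse q hq, fun q hq => ?_⟩
    rw [lieBracket_add_right (hu q hq).differentiableAt (hw q hq).differentiableAt,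
      h₃.bracket q hq]
    simp
  have hDw : IsCommutingFrame V D w := by
    refine ⟨hDan, hw, fun q hq => by simpa [hD] using h₃.transverse q hq, fun q hq => ?_⟩
    rw [lieBracket_add_left (hu q hq).differentiableAt (hw q hq).differentiableAt,
      h₃.bracket q hq]
    simp
  have hpar : ∀ {e f m : Plane}, m ≠ 0 → area e m = 0 → area f m = 0 → area e f = 0 :=
    fun hm he hf => area_eq_zero_trans hm he (area_eq_zero_comm.1 hf)
  obtain ⟨A₂, B₂, hA₂, hB₂, -, hB₂0, hx, hy, hA₂D, hB₂u⟩ := huD.exists_factors hV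
    h₂.toIsCommutingFrame
    (fun q hq => hpar (ha0 q hq) (h₂.area_left q hq) (h₃.area_left q hq))
    (fun q hq => hpar (hY0 q hq) (h₂.area_right q hq) (h₃.area_add q hq))
  obtain ⟨A₁, B₁, hA₁, hB₁, hA₁0, hB₁0, hz, ht, hA₁w, hB₁D⟩ := hDw.exists_factors hV
    h₁.toIsCommutingFrame
    (fun q hq => hpar (hY0 q hq) (h₁.area_left q hq) (h₃.area_add q hq))
    (fun q hq => hpar (hb0 q hq) (h₁.area_right q hq) (h₃.area_right q hq))
  -- the third directions of the two frames are that of `u + s w`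
  have e₂ : ∀ q ∈ V, B₂ q = (A₂ q + B₂ q) * s q := by
    intro q hq
    have h := hpar (hc0 q hq) (h₂.area_add q hq) (hc q hq)
    rw [hx q hq, hy q hq] at h
    simp only [hD, Pi.add_apply, map_add, map_smul, add_apply, smul_apply, area_self,
      smul_eq_mul, area_swap (w q) (u q)] at h
    apply mul_right_cancel₀ (h₃.transverse q hq)
    linear_combination -h
  have e₁ : ∀ q ∈ V, A₁ q * s q = A₁ q + B₁ q := by
    intro q hq
    have h := hpar (hc0 q hq) (h₁.area_add q hq) (hc q hq)
    rw [hz q hq, ht q hq] at h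
    simp only [hD, Pi.add_apply, map_add, map_smul, add_apply, smul_apply, area_self,
      smul_eq_mul, area_swap (w q) (u q)] at h
    apply mul_right_cancel₀ (h₃.transverse q hq)
    linear_combination h
  have hs1 : ∀ q ∈ V, 1 - s q ≠ 0 := by
    intro q hq h0
    apply hB₁0 q hq
    linear_combination -e₁ q hq - A₁ q * h0
  -- the derivatives of the factors along `D`
  set P : Plane → ℂ := fun q => fderiv ℂ A₁ q (D q) with hP
  set Q : Plane → ℂ := fun q => fderiv ℂ B₂ q (D q) with hQ
  have hPan : AnalyticOnNhd ℂ P V := fun q hq => analyticAt_fderiv_apply (hA₁ q hq) (hDan q hq)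
  have hQan : AnalyticOnNhd ℂ Q V := fun q hq => analyticAt_fderiv_apply (hB₂ q hq) (hDan q hq)
  have d₁ : ∀ q ∈ V, A₁ q * fderiv ℂ s q (D q) = (1 - s q) * P q := by
    intro q hq
    have h1 : (fun p => A₁ p * s p) =ᶠ[𝓝 q] fun p => A₁ p + B₁ p :=
      mem_of_superset (hV.mem_nhds hq) e₁
    have h2 := congrArg (fun L : Plane →L[ℂ] ℂ => L (D q)) h1.fderiv_eq
    rw [fderiv_fun_mul (hA₁ q hq).differentiableAt (hs q hq).differentiableAt,
      fderiv_fun_add (hA₁ q hq).differentiableAt (hB₁ q hq).differentiableAt] at h2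
    simp only [add_apply, smul_apply, smul_eq_mul, hB₁D q hq] at h2
    simp only [hP]
    linear_combination h2
  have d₂ : ∀ q ∈ V, B₂ q * fderiv ℂ s q (D q) = s q * (1 - s q) * Q q := by
    intro q hq
    have h1 : B₂ =ᶠ[𝓝 q] fun p => (A₂ p + B₂ p) * s p := mem_of_superset (hV.mem_nhds hq) e₂
    have h2 := congrArg (fun L : Plane →L[ℂ] ℂ => L (D q)) h1.fderiv_eq
    rw [fderiv_fun_mul ((hA₂ q hq).differentiableAt.fun_add (hB₂ q hq).differentiableAt)
      (hs q hq).differentiableAt,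
      fderiv_fun_add (hA₂ q hq).differentiableAt (hB₂ q hq).differentiableAt] at h2
    simp only [add_apply, smul_apply, smul_eq_mul, hA₂D q hq, zero_add] at h2
    simp only [hQ]
    linear_combination fderiv ℂ s q (D q) * e₂ q hq - s q * h2
  intro q₀ hq₀
  by_contra hne
  set W : Set Plane := V ∩ (fun q => P q * Q q) ⁻¹' {0}ᶜ with hW
  have hWo : IsOpen W :=
    (hPan.mul hQan).continuousOn.isOpen_inter_preimage hV isOpen_compl_singleton
  have hPQ : ∀ q ∈ W, P q ≠ 0 ∧ Q q ≠ 0 := fun q hq => mul_ne_zero_iff.1 hq.2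
  have hW0 : W.Nonempty := by
    refine ⟨q₀, hq₀, mul_ne_zero ?_ ?_⟩
    · intro h0
      have := d₁ q₀ hq₀
      rw [h0, mul_zero] at this
      exact mul_ne_zero (hA₁0 q₀ hq₀) hne this
    · intro h0
      have := d₂ q₀ hq₀
      rw [h0, mul_zero] at this
      exact mul_ne_zero (hB₂0 q₀ hq₀) hne this
  set F : Plane → ℂ := fun q => A₁ q / P q with hF
  set G : Plane → ℂ := fun q => B₂ q / Q q with hG
  have hFan : AnalyticOnNhd ℂ F W := fun q hq =>
    (hA₁ q hq.1).div (hPan q hq.1) (hPQ q hq).1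
  have hGan : AnalyticOnNhd ℂ G W := fun q hq =>
    (hB₂ q hq.1).div (hQan q hq.1) (hPQ q hq).2
  have hFw : ∀ q ∈ W, fderiv ℂ F q (w q) = 0 := fun q hq =>
    fderiv_div_apply_eq_zero (hA₁ q hq.1).differentiableAt (hPan q hq.1).differentiableAt
      (hPQ q hq).1 (hA₁w q hq.1) (fderiv_fderiv_eq_zero_of_bracket hV hq.1 (hA₁ q hq.1)
        (hw q hq.1) (hDan q hq.1) (by rw [lieBracket_swap, hDw.bracket q hq.1, neg_zero]) hA₁w)
  have hGu : ∀ q ∈ W, fderiv ℂ G q (u q) = 0 := fun q hq =>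
    fderiv_div_apply_eq_zero (hB₂ q hq.1).differentiableAt (hQan q hq.1).differentiableAt
      (hPQ q hq).2 (hB₂u q hq.1) (fderiv_fderiv_eq_zero_of_bracket hV hq.1 (hB₂ q hq.1)
        (hu q hq.1) (hDan q hq.1) (huD.bracket q hq.1) hB₂u)
  have hGF : ∀ q ∈ W, G q = s q * F q := by
    intro q hq
    have hP0 := (hPQ q hq).1
    have hQ0 := (hPQ q hq).2
    simp only [hF, hG]
    field_simp
    apply mul_left_cancel₀ (hs1 q hq.1)
    linear_combination A₁ q * d₂ q hq.1 - B₂ q * d₁ q hq.1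
  refine hno W (fun q => F q • u q) (fun q => G q • w q) hWo hW0 inter_subset_left
    ⟨⟨hFan.smul (hu.mono inter_subset_left), hGan.smul (hw.mono inter_subset_left), ?_, ?_⟩,
      ?_, ?_, ?_⟩
  · intro q hq
    simp [hF, hG, hPQ q hq, h₃.transverse q hq.1, hA₁0 q hq.1, hB₂0 q hq.1]
  · intro q hq
    rw [lieBracket_smul_smul (hFan q hq).differentiableAt (hGan q hq).differentiableAt
      (hu q hq.1).differentiableAt (hw q hq.1).differentiableAt, hFw q hq, hGu q hq,
      h₃.bracket q hq.1]
    simp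
  · intro q hq
    simp [h₃.area_left q hq.1]
  · intro q hq
    simp [h₃.area_right q hq.1]
  · intro q hq
    have h1 : F q • u q + G q • w q = F q • (u q + s q • w q) := by
      rw [hGF q hq]
      module
    rw [h1, map_smul, smul_apply, hc q hq.1, smul_zero]

/-! ### Flatness and symmetries -/

theorem theorem2 (Ω : Set Plane) (hΩ : IsOpen Ω) (hconn : IsPreconnected Ω)
    (v₁ v₂ v₃ Y : Plane → Plane)
    (hweb : IsWeb Ω ![v₁, v₂, v₃]) (hnonflat : ¬ IsFlatWeb Ω ![v₁, v₂, v₃])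
    (hY : AnalyticOnNhd ℂ Y Ω) :
    -- a nontrivial symmetry is transverse to the leaves at generic points, and there it generates
    -- three flat webs
    ((∃ p ∈ Ω, Y p ≠ 0) → IsInfinitesimalSymmetry Ω ![v₁, v₂, v₃] Y →
      Ω ⊆ closure (transversalityLocus Ω ![v₁, v₂, v₃] Y) ∧
      IsFlatWeb (transversalityLocus Ω ![v₁, v₂, v₃] Y) ![Y, v₂, v₃] ∧
      IsFlatWeb (transversalityLocus Ω ![v₁, v₂, v₃] Y) ![v₁, Y, v₃] ∧
      IsFlatWeb (transversalityLocus Ω ![v₁, v₂, v₃] Y) ![v₁, v₂, Y]) ∧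
    -- if the three triples generate 3-webs on the whole of `Ω`, then there is an equivalence
    (IsWeb Ω ![Y, v₂, v₃] → IsWeb Ω ![v₁, Y, v₃] → IsWeb Ω ![v₁, v₂, Y] →
      (HasSymmetryAlong Ω ![v₁, v₂, v₃] Y ↔
        IsFlatWeb Ω ![Y, v₂, v₃] ∧ IsFlatWeb Ω ![v₁, Y, v₃] ∧ IsFlatWeb Ω ![v₁, v₂, Y])) := by
  obtain ⟨⟨ha, hb, hc⟩, hab, hbc, hac⟩ := isWeb_iff.1 hweb
  have hno : ∀ V u w, IsOpen V → V.Nonempty → V ⊆ Ω → ¬ IsParallelFrame V v₁ v₂ v₃ u w :=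
    fun V u w hV hne hVΩ h => hnonflat (isFlatWeb_of_isParallelFrame hΩ hconn hweb hV hne hVΩ h)
  refine ⟨fun hY0 hsymm => ?_, fun hw₁ hw₂ hw₃ => ⟨fun hsymm => ?_, ?_⟩⟩
  · set T := transversalityLocus Ω ![v₁, v₂, v₃] Y with hT
    have hTΩ : T ⊆ Ω := fun q hq => hq.1
    have hTo : IsOpen T := isOpen_transversalityLocus hΩ hweb.holomorphic hY
    have hYa : ∀ q ∈ T, area (Y q) (v₁ q) ≠ 0 := fun q hq =>
      linearIndependent_pair_iff_area.1 (hq.2 0)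
    have hYb : ∀ q ∈ T, area (Y q) (v₂ q) ≠ 0 := fun q hq =>
      linearIndependent_pair_iff_area.1 (hq.2 1)
    have hYc : ∀ q ∈ T, area (Y q) (v₃ q) ≠ 0 := fun q hq =>
      linearIndependent_pair_iff_area.1 (hq.2 2)
    have hab' := fun q hq => mt area_eq_zero_comm.1 (hab q hq)
    have hbc' := fun q hq => mt area_eq_zero_comm.1 (hbc q hq)
    have hac' := fun q hq => mt area_eq_zero_comm.1 (hac q hq)
    constructor
    · have hbr := fun i q (hq : q ∈ Ω) =>
        area_lieBracket_eq_zero_of_symmetry hweb.holomorphic hsymm i hq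
      have hopen : ∀ (v : Plane → Plane) (V : Set Plane), AnalyticOnNhd ℂ v Ω → IsOpen V →
          V ⊆ Ω → IsOpen (V ∩ (fun q => area (Y q) (v q)) ⁻¹' {0}ᶜ) := by
        intro v V hv hV hVΩ
        have h : ContinuousOn (fun q => area (Y q) (v q)) V := fun q hq =>
          (analyticAt_area (hY q (hVΩ hq)) (hv q (hVΩ hq))).continuousAt.continuousWithinAt
        exact h.isOpen_inter_preimage hV isOpen_compl_singleton
      intro p hp
      by_contra hpT
      -- successively shrink the complement of the closure to the points of transversality
      set V := Ω ∩ (closure T)ᶜ with hV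
      have hVo : IsOpen V := hΩ.inter isClosed_closure.isOpen_compl
      have hVΩ : V ⊆ Ω := inter_subset_left
      obtain ⟨q₁, hq₁⟩ := exists_area_ne_zero_of_bracket hconn hY hY0 hb hc hab hac hbc
        (hbr 1) (hbr 2) hno hVo ⟨p, hp, hpT⟩ hVΩ
      obtain ⟨q₂, hq₂⟩ := exists_area_ne_zero_of_bracket hconn hY hY0 ha hc hab' hbc hac
        (hbr 0) (hbr 2) (fun W u w hW hne hWΩ h => hno W _ _ hW hne hWΩ h.swap)
        (hopen v₁ V ha hVo hVΩ) ⟨q₁, hq₁⟩ (inter_subset_left.trans hVΩ)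
      obtain ⟨q₃, hq₃⟩ := exists_area_ne_zero_of_bracket hconn hY hY0 ha hb hac' hbc' hab
        (hbr 0) (hbr 1) (fun W u w hW hne hWΩ h => hno W _ _ hW hne hWΩ h.swap.rotate)
        (hopen v₂ _ hb (hopen v₁ V ha hVo hVΩ) (inter_subset_left.trans hVΩ)) ⟨q₂, hq₂⟩
        (inter_subset_left.trans (inter_subset_left.trans hVΩ))
      refine hq₃.1.1.1.2 (subset_closure ⟨hq₃.1.1.1.1, fun i => ?_⟩)
      rw [linearIndependent_pair_iff_area]
      fin_cases i
      exacts [hq₃.1.1.2, hq₃.1.2, hq₃.2]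
    · have hsymmT : ∀ i, ∀ q ∈ T, area (lieBracket ℂ Y (![v₁, v₂, v₃] i) q)
          (![v₁, v₂, v₃] i q) = 0 := fun i q hq =>
        area_lieBracket_eq_zero_of_symmetry hweb.holomorphic hsymm i (hTΩ hq)
      have hYT := hY.mono hTΩ
      have haT := ha.mono hTΩ
      have hbT := hb.mono hTΩ
      have hcT := hc.mono hTΩ
      obtain ⟨⟨u₁, w₁, h₁⟩, ⟨u₂, w₂, h₂⟩, ⟨u₃, w₃, h₃⟩⟩ :=
        exists_isParallelFrame_of_bracket_web hTo (hweb.mono hTΩ) hYT hYa hYb hYc hsymmT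
          (fun q _ => area_self _)
      refine ⟨(isFlatWeb_iff (isWeb_iff.2 ⟨⟨hYT, hbT, hcT⟩, hYb, fun q hq => hbc q (hTΩ hq),
          hYc⟩)).2 fun p hp => ⟨T, u₁, w₁, hTo, hp, subset_rfl, h₁⟩,
        (isFlatWeb_iff (isWeb_iff.2 ⟨⟨haT, hYT, hcT⟩,
          fun q hq => mt area_eq_zero_comm.1 (hYa q hq), hYc,
          fun q hq => hac q (hTΩ hq)⟩)).2 fun p hp => ⟨T, u₂, w₂, hTo, hp, subset_rfl, h₂⟩,
        (isFlatWeb_iff (isWeb_iff.2 ⟨⟨haT, hbT, hYT⟩, fun q hq => hab q (hTΩ hq),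
          fun q hq => mt area_eq_zero_comm.1 (hYb q hq),
          fun q hq => mt area_eq_zero_comm.1 (hYa q hq)⟩)).2
          fun p hp => ⟨T, u₃, w₃, hTo, hp, subset_rfl, h₃⟩⟩
  · obtain ⟨-, hYb, -, hYc⟩ := isWeb_iff.1 hw₁
    obtain ⟨-, haY, -, -⟩ := isWeb_iff.1 hw₂
    have key : ∀ p ∈ Ω, ∃ V, IsOpen V ∧ p ∈ V ∧ V ⊆ Ω ∧
        (∃ u w, IsParallelFrame V Y v₂ v₃ u w) ∧ (∃ u w, IsParallelFrame V v₁ Y v₃ u w) ∧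
        ∃ u w, IsParallelFrame V v₁ v₂ Y u w := by
      intro p hp
      obtain ⟨V, f, hV, hpV, hVΩ, hf, hf0, hfY⟩ := hsymm p hp
      refine ⟨V, hV, hpV, hVΩ, exists_isParallelFrame_of_bracket_web hV (hweb.mono hVΩ)
        (hf.smul (hY.mono hVΩ)) ?_ ?_ ?_ (fun i q hq => area_lieBracket_eq_zero_of_symmetry
          (hweb.mono hVΩ).holomorphic hfY i hq) ?_⟩
      · intro q hq
        simpa [hf0 q hq] using mt area_eq_zero_comm.1 (haY q (hVΩ hq))
      · intro q hq
        simpa [hf0 q hq] using hYb q (hVΩ hq)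
      · intro q hq
        simpa [hf0 q hq] using hYc q (hVΩ hq)
      · intro q _
        simp
    refine ⟨(isFlatWeb_iff hw₁).2 fun p hp => ?_, (isFlatWeb_iff hw₂).2 fun p hp => ?_,
      (isFlatWeb_iff hw₃).2 fun p hp => ?_⟩ <;>
    obtain ⟨V, hV, hpV, hVΩ, ⟨u₁, w₁, h₁⟩, ⟨u₂, w₂, h₂⟩, ⟨u₃, w₃, h₃⟩⟩ := key p hp
    exacts [⟨V, u₁, w₁, hV, hpV, hVΩ, h₁⟩, ⟨V, u₂, w₂, hV, hpV, hVΩ, h₂⟩,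
      ⟨V, u₃, w₃, hV, hpV, hVΩ, h₃⟩]
  · rintro ⟨hf₁, hf₂, hf₃⟩ p hp
    obtain ⟨V₁, z, t, hV₁, hp₁, hV₁Ω, h₁⟩ := (isFlatWeb_iff hw₁).1 hf₁ p hp
    obtain ⟨V₂, x, y, hV₂, hp₂, -, h₂⟩ := (isFlatWeb_iff hw₂).1 hf₂ p hp
    obtain ⟨V₃, u, w, hV₃, hp₃, -, h₃⟩ := (isFlatWeb_iff hw₃).1 hf₃ p hp
    set V := V₁ ∩ V₂ ∩ V₃ with hVdef
    have hV : IsOpen V := (hV₁.inter hV₂).inter hV₃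
    have hVΩ : V ⊆ Ω := fun q hq => hV₁Ω hq.1.1
    replace h₁ : IsParallelFrame V Y v₂ v₃ z t := h₁.mono fun q hq => hq.1.1
    replace h₂ : IsParallelFrame V v₁ Y v₃ x y := h₂.mono fun q hq => hq.1.2
    replace h₃ : IsParallelFrame V v₁ v₂ Y u w := h₃.mono fun q hq => hq.2
    have ha0 : ∀ q ∈ V, v₁ q ≠ 0 := fun q hq => left_ne_zero_of_area (hab q (hVΩ hq))
    have hb0 : ∀ q ∈ V, v₂ q ≠ 0 := fun q hq => right_ne_zero_of_area (hab q (hVΩ hq))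
    have hc0 : ∀ q ∈ V, v₃ q ≠ 0 := fun q hq => right_ne_zero_of_area (hac q (hVΩ hq))
    have haY : ∀ q ∈ V, area (v₁ q) (Y q) ≠ 0 := fun q hq =>
      (isWeb_iff.1 hw₂).2.1 q (hVΩ hq)
    have hY0 : ∀ q ∈ V, Y q ≠ 0 := fun q hq => right_ne_zero_of_area (haY q hq)
    have hwc : ∀ q ∈ V, area (w q) (v₃ q) ≠ 0 := fun q hq h0 => hbc q (hVΩ hq)
      (area_eq_zero_trans (right_ne_zero_of_area (h₃.transverse q hq))
        (area_eq_zero_comm.1 (h₃.area_right q hq)) h0)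
    -- the slope of `v₃` in the frame
    set s : Plane → ℂ := fun q => -(area (u q) (v₃ q) / area (w q) (v₃ q)) with hs
    have hsan : AnalyticOnNhd ℂ s V := fun q hq =>
      ((analyticAt_area (h₃.left q hq) (hc q (hVΩ hq))).div
        (analyticAt_area (h₃.right q hq) (hc q (hVΩ hq))) (hwc q hq)).neg
    have hsc : ∀ q ∈ V, area (u q + s q • w q) (v₃ q) = 0 := by
      intro q hq
      simp [hs, hwc q hq]
    have hds := fderiv_slope_eq_zero hV h₃ h₂ h₁ hsan hsc ha0 hb0 hc0 hY0
      (fun W f g hW hne hWV => hno W f g hW hne (hWV.trans hVΩ))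
    set f : Plane → ℂ := fun q => area (v₁ q) (u q + w q) / area (v₁ q) (Y q) with hf
    have hfY : ∀ q ∈ V, f q • Y q = u q + w q := fun q hq =>
      (eq_area_smul (haY q hq) (h₃.area_add q hq)).symm
    refine ⟨V, f, hV, ⟨⟨hp₁, hp₂⟩, hp₃⟩, hVΩ, ?_, ?_, ?_⟩
    · exact fun q hq => (analyticAt_area (ha q (hVΩ hq))
        ((h₃.left q hq).add (h₃.right q hq))).div
        (analyticAt_area (ha q (hVΩ hq)) (hY q (hVΩ hq))) (haY q hq)
    · intro q hq h0
      have h := hfY q hq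
      rw [h0, zero_smul] at h
      have h' : area (u q) (u q + w q) = 0 := by rw [← h, map_zero]
      exact h₃.transverse q hq (by simpa using h')
    · exact isInfinitesimalSymmetry_of_frame hV h₃.toIsCommutingFrame hsan hds hfY ha0 hb0 hc0
        h₃.area_left h₃.area_right hsc
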